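/- Let $K$ be a field. A simplicial complex $\Delta$ on a finite vertex set $V=V(\Delta)$ is a family of subsets of $V$ (its faces) that contains $\emptyset$ and is closed under taking subsets; $\Delta$ is a simplex if its faces are exactly the subsets of some set $F\subseteq V$, and $\dim\Delta=\max_{F\in\Delta}|F|-1$. Let $S=K[x_v : v\in V]$ and let $I_\Delta\subseteq S$ be the Stanley–Reisner ideal, generated by the monomials $x_N=\prod_{v\in N}x_v$ with $N\subseteq V$, $N\notin\Delta$. *Inseparability.* A monomial ideal $J\subseteq S[y]$ is a separation of a squarefree monomial ideal $I\subseteq S$ for the variable $x_i$ if (i) $I$ is the image of $J$ under the $K$-algebra homomorphism $S[y]\to S$ with $y\mapsto x_i$ and $x_j\mapsto x_j$ for all $j$; (ii) $x_i$ divides some minimal monomial generator of $J$, and $y$ divides some minimal monomial generator of $J$; (iii) $y-x_i$ is a non-zero-divisor on $S[y]/J$. The complex $\Delta$ is inseparable if $I_\Delta$ has no separation for any variable $x_i$. *Rigidity.* Let $I\subseteq S$ be an ideal. For an ideal $J\subseteq S[\epsilon]$, $\epsilon^2=0$, the ring $S[\epsilon]/J$ is an infinitesimal deformation of $S/I$ if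 $K[\epsilon]\to S[\epsilon]/J$ is flat and the image of $J$ under $S[\epsilon]\to S$, $\epsilon\mapsto 0$, is $I$; it is trivial if some $K$-algebra automorphism of $S[\epsilon]$ maps $J$ to $IS[\epsilon]$. The complex $\Delta$ is rigid if every infinitesimal deformation of $S/I_\Delta$ is trivial. *$\emptyset$-rigidity.* Let $T^1(\Delta)$ be the cokernel of the map $\mathrm{Der}_K(S)\to \mathrm{Hom}_S(I_\Delta,S/I_\Delta)$, $\partial\mapsto (f\mapsto \partial f+I_\Delta)$, with its natural $\mathbb Z^{V}$-grading. The complex $\Delta$ is $\emptyset$-rigid if $T^1(\Delta)_{-b}=0$ for all $b\in\{0,1\}^{V}$. **Theorem.** Let $\Delta_1\neq\{\emptyset\}$ and $\Delta_2\neq\{\emptyset\}$ be simplicial complexes on disjoint finite vertex sets $V(\Delta_1)$ and $V(\Delta_2)$ such that $\{v\}\in\Delta_i$ for all $v\in V(\Delta_i)$, $i=1,2$. Let $\Delta_1\cup\Delta_2$ be their disjoint union: the complex on $V(\Delta_1)\cup V(\Delta_2)$ whose faces are the faces of $\Delta_1$ and the faces of $\Delta_2$. (a) The following conditions are equivalent: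 (1) $\Delta_1\cup\Delta_2$ is inseparable; (2) $\Delta_1$ and $\Delta_2$ are simplices. (b) The following conditions are equivalent: (1) $\Delta_1\cup\Delta_2$ is rigid; (2) $\Delta_1\cup\Delta_2$ is $\emptyset$-rigid; (3) $\Delta_1$ and $\Delta_2$ are simplices and $\dim\Delta_1+\dim\Delta_2>0$. -/

import Mathlib

open scoped DualNumber

noncomputable section

/-! ### Simplicial complexes

A simplicial complex on a finite vertex set `V` is a `PreAbstractSimplicialComplex V`; a vertex
need not be a face. In this Mathlib structure the collection of faces consists of the nonempty
faces only: the empty set is a face by convention, and is not listed. Thus `⊥` is the complex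
whose only face is the empty set. -/

namespace PreAbstractSimplicialComplex

variable {V V₁ V₂ : Type*}

/-- `Δ` is a simplex: its faces are exactly the subsets of some set `F`. -/
def IsSimplex (Δ : PreAbstractSimplicialComplex V) : Prop :=
  ∃ F : Finset V, ∀ G : Finset V, G ∈ Δ.faces ↔ G.Nonempty ∧ G ⊆ F

/-- The dimension: the largest cardinality of a face, minus one (so `-1` if there is no nonempty
face). For finite `V` the set of cardinalities is bounded. -/
def dim (Δ : PreAbstractSimplicialComplex V) : ℤ :=
  ((sSup (Finset.card '' Δ.faces) : ℕ) : ℤ) - 1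

open Classical in
/-- The disjoint union: the vertex set is the disjoint union of the two vertex sets, and a set is a
face iff it is a face of `Δ₁` or a face of `Δ₂`. -/
def disjointUnion (Δ₁ : PreAbstractSimplicialComplex V₁) (Δ₂ : PreAbstractSimplicialComplex V₂) :
    PreAbstractSimplicialComplex (V₁ ⊕ V₂) :=
  Δ₁.map Sum.inl ⊔ Δ₂.map Sum.inr

/-- The Stanley–Reisner ideal: generated by the monomials `∏ i ∈ N, x_i`, `N` a non-face. -/
def stanleyReisnerIdeal (K : Type*) [Field K] (Δ : PreAbstractSimplicialComplex V) :
    Ideal (MvPolynomial V K) :=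
  Ideal.span {f | ∃ N : Finset V, N.Nonempty ∧ N ∉ Δ.faces ∧ f = ∏ i ∈ N, MvPolynomial.X i}

end PreAbstractSimplicialComplex

/-! ### Infinitesimal deformations and rigidity -/

section Deformation

variable (K : Type*) {S : Type*} [Field K] [CommRing S] [Algebra K S]

/-- The canonical map `K[ε] → S[ε]`, `a + bε ↦ a + bε`. -/
def dualNumberInclusion (S : Type*) [CommRing S] [Algebra K S] : K[ε] →ₐ[K] S[ε] :=
  DualNumber.lift ⟨(Algebra.ofId K S[ε], DualNumber.eps),
    DualNumber.eps_mul_eps, fun _ => Commute.all _ _⟩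

/-- `S[ε]/J` is an infinitesimal deformation of `S/I`: the map `K[ε] → S[ε]/J` is flat, and
reduction modulo `ε` yields `S/I`, that is, `J` reduces to `I` modulo `ε`. -/
def IsInfinitesimalDeformation (I : Ideal S) (J : Ideal S[ε]) : Prop :=
  RingHom.Flat (R := K[ε]) (S := S[ε] ⧸ J)
      ((Ideal.Quotient.mk J).comp (dualNumberInclusion K S).toRingHom) ∧
    J.map (TrivSqZeroExt.fstHom S S S) = I

/-- The deformation given by `J` is trivial: a `K`-algebra automorphism of `S[ε]` maps `J` to
`I S[ε]`. -/
def IsTrivialDeformation (I : Ideal S) (J : Ideal S[ε]) : Prop :=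
  ∃ σ : S[ε] ≃ₐ[K] S[ε], J.map σ = I.map (algebraMap S S[ε])

/-- `S/I` is rigid over `K`: every infinitesimal deformation of it is trivial. -/
def IsRigidQuotient (I : Ideal S) : Prop :=
  ∀ J : Ideal S[ε], IsInfinitesimalDeformation K I J → IsTrivialDeformation K I J

/-! ### The first cotangent functor -/

/-- The natural map `δ* : Der_K(S) → Hom_S(I, S/I)`, `∂ ↦ (f ↦ ∂ f + I)`. -/
def derivationToHom (I : Ideal S) : Derivation K S S →ₗ[S] (I →ₗ[S] S ⧸ I) where
  toFun D :=
    { toFun := fun f => Ideal.Quotient.mk I (D f)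
      map_add' := fun f g => by simp
      map_smul' := fun r f => by
        have h : Ideal.Quotient.mk I ((f : S) * D r) = 0 :=
          Ideal.Quotient.eq_zero_iff_mem.2 (I.mul_mem_right _ f.2)
        simp only [Submodule.coe_smul, smul_eq_mul, Derivation.leibniz, map_add, h, add_zero,
          RingHom.id_apply]
        rfl }
  map_add' D E := by ext f; simp
  map_smul' r D := by ext f; rfl

/-- `T¹(S/I)`, the cokernel of `δ*`. -/
abbrev CotangentT1 (I : Ideal S) : Type _ :=
  (I →ₗ[S] S ⧸ I) ⧸ LinearMap.range (derivationToHom K I)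

end Deformation

section Grading

variable {K V : Type*} [Field K]

/-- The component of degree `d ∈ ℤ^V` of `S/I`: spanned by the class of the monomial `x^d` if `d`
is nonnegative, and zero otherwise. -/
def quotientDegree (I : Ideal (MvPolynomial V K)) (d : V → ℤ) :
    Submodule K (MvPolynomial V K ⧸ I) :=
  Submodule.span K {q | ∃ u : V →₀ ℕ, (∀ v, (u v : ℤ) = d v) ∧
    q = Ideal.Quotient.mk I (MvPolynomial.monomial u 1)}

/-- For a monomial ideal `I`, the homomorphisms `I → S/I` that are homogeneous of degree
`c ∈ ℤ^V`: they send elements of degree `u` to elements of degree `u + c`. -/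
def homDegree (I : Ideal (MvPolynomial V K)) (c : V → ℤ) :
    Submodule K (I →ₗ[MvPolynomial V K] MvPolynomial V K ⧸ I) where
  carrier := {φ | ∀ (f : I) (u : V →₀ ℕ) (a : K), (f : MvPolynomial V K) =
    MvPolynomial.monomial u a → φ f ∈ quotientDegree I (fun v => (u v : ℤ) + c v)}
  add_mem' hφ hψ f u a h := Submodule.add_mem _ (hφ f u a h) (hψ f u a h)
  zero_mem' _ _ _ _ := Submodule.zero_mem _
  smul_mem' r _ hφ f u a h := Submodule.smul_mem _ r (hφ f u a h)

/-- For a monomial ideal `I`, the component of degree `c ∈ ℤ^V` of `T¹(S/I)`: the classes of the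
homomorphisms of degree `c`. -/
def cotangentT1Degree (I : Ideal (MvPolynomial V K)) (c : V → ℤ) :
    Submodule K (CotangentT1 K I) :=
  (homDegree I c).map ((LinearMap.range (derivationToHom K I)).mkQ.restrictScalars K)

/-! ### Separations -/

/-- The ideal `J` is generated by monomials. -/
def IsMonomialIdeal {W : Type*} (J : Ideal (MvPolynomial W K)) : Prop :=
  ∃ s : Set (W →₀ ℕ), J = Ideal.span ((fun u => MvPolynomial.monomial u (1 : K)) '' s)

/-- `x^u` is a minimal monomial generator of the monomial ideal `J`: it is minimal with respect to
divisibility among the monomials in `J`. -/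
def IsMinimalGenerator {W : Type*} (J : Ideal (MvPolynomial W K)) (u : W →₀ ℕ) : Prop :=
  Minimal (fun w : W →₀ ℕ => MvPolynomial.monomial w (1 : K) ∈ J) u

/-- `J ⊆ S[y]` is a separation of `I ⊆ S` for the variable `x_i`. Here `S[y]` is the polynomial
ring on `Option V`, where `none` gives the new variable `y` and `some j` gives `x_j`. -/
structure IsSeparation (I : Ideal (MvPolynomial V K)) (i : V)
    (J : Ideal (MvPolynomial (Option V) K)) : Prop where
  monomial : IsMonomialIdeal J
  map_eq : J.map (MvPolynomial.aeval (R := K)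
    (fun o : Option V => o.elim (MvPolynomial.X i) MvPolynomial.X)) = I
  dvd_x : ∃ u, IsMinimalGenerator J u ∧ u (some i) ≠ 0
  dvd_y : ∃ u, IsMinimalGenerator J u ∧ u none ≠ 0
  regular : Ideal.Quotient.mk J (MvPolynomial.X none - MvPolynomial.X (some i)) ∈
    nonZeroDivisors (MvPolynomial (Option V) K ⧸ J)

end Grading

namespace PreAbstractSimplicialComplex

variable (K : Type*) [Field K] {V : Type*}

/-- `Δ` is (algebraically) rigid over `K`. -/
def IsRigid (Δ : PreAbstractSimplicialComplex V) : Prop :=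
  IsRigidQuotient K (Δ.stanleyReisnerIdeal K)

/-- `Δ` is `∅`-rigid over `K`: `T¹(Δ)_{-b} = 0` for all `b ∈ {0,1}^V`. -/
def IsEmptyRigid (Δ : PreAbstractSimplicialComplex V) : Prop :=
  ∀ b : V → ℤ, (∀ v, b v = 0 ∨ b v = 1) →
    cotangentT1Degree (Δ.stanleyReisnerIdeal K) (-b) = ⊥

/-- `Δ` is inseparable over `K`: its Stanley–Reisner ideal has no separation for any variable. -/
def IsInseparable (Δ : PreAbstractSimplicialComplex V) : Prop :=
  ¬ ∃ (i : V) (J : Ideal (MvPolynomial (Option V) K)),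
    IsSeparation (Δ.stanleyReisnerIdeal K) i J

end PreAbstractSimplicialComplex

end

/-!
An infinitesimal deformation of `S/I` is the ideal of all `f + gε` with `f ∈ I` and `g ≡ φ f` for a
homomorphism `φ : I → S/I`. As `S` is reduced, an automorphism of `S[ε]` preserves `(ε)`, so up to
an automorphism of `S` and a unit it is given by a derivation. Hence `S/I` is rigid exactly when
every homomorphism `I → S/I` comes from a derivation.

Suppose that every face of `Δ` lies in `A` or in its complement, and let `v` be a vertex of a
minimal non-face `N ⊆ A`. Splitting `v` into two vertices, the new one coned over the faces in `A`
and the old one over the faces outside `A`, separates `I_Δ` at `x_v`. Moreover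
`f ↦ (∂f/∂x_v)|_{x_a = 0, a ∈ A}` is a homomorphism `I_Δ → S/I_Δ` of degree `-v`. It is not induced
by a derivation `D`: since it maps `x_v x_w` to `x_w` for `w ∉ A`, the constant term of `D x_v`
would be `1`, and since it maps `x_N` to `0`, that constant term would be `0`.

For two simplices, `I_Δ` is generated by the products `x_a x_b` with `a` and `b` in different parts.
In a separation `J` at `x_v`, two generators `x_v x_a` and `y x_b` of `J` would give
`(y - x_v) x_a x_b ∈ J`, hence `x_a x_b ∈ I_Δ`, which is false; so only one of `x_v` and `y` occurs
in the minimal generators of `J`. On the two components of the zero set of `I_Δ`, a homomorphism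
`I_Δ → S/I_Δ` has the shape `x_a x_b ↦ x_a G_b` and `x_a x_b ↦ x_b H_a`, so `x_a ↦ H_a`, `x_b ↦ G_b`
is a derivation inducing it. This needs a part with two vertices: for two points, `x_a x_b ↦ 1` is a
nonzero class of `T¹`.
-/

section DualNumberFlatness

open TensorProduct

theorem exists_eq_tmul_of_span_singleton {R M : Type*} [CommRing R] [AddCommGroup M]
    [Module R M] (a : R) (t : Ideal.span {a} ⊗[R] M) :
    ∃ m : M, t = (⟨a, Ideal.mem_span_singleton_self a⟩ : Ideal.span {a}) ⊗ₜ[R] m := by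
  induction t using TensorProduct.induction_on with
  | zero => exact ⟨0, by rw [tmul_zero]⟩
  | tmul x y =>
    obtain ⟨c, hc⟩ := Ideal.mem_span_singleton'.1 x.2
    refine ⟨c • y, ?_⟩
    rw [← smul_tmul]
    congr 1
    exact Subtype.ext hc.symm
  | add x y hx hy =>
    obtain ⟨m, rfl⟩ := hx
    obtain ⟨n, rfl⟩ := hy
    exact ⟨m + n, by rw [tmul_add]⟩

theorem exists_eq_eps_smul_of_flat {R M : Type*} [CommRing R] [AddCommGroup M] [Module R[ε] M]
    [Module.Flat R[ε] M] {m : M} (h : (ε : R[ε]) • m = 0) : ∃ m' : M, m = (ε : R[ε]) • m' := by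
  have hrel : ∑ i : Unit, (fun _ => (ε : R[ε])) i • (fun _ => m) i = 0 := by simpa using h
  obtain ⟨k, a, y, hm, ha⟩ := Module.Flat.isTrivialRelation_of_sum_smul_eq_zero hrel
  have heps_dvd (j : Fin k) : ε ∣ a () j := by
    have hzero : (ε : R[ε]) * a () j = 0 := by simpa using ha j
    rw [← DualNumber.fst_eq_zero_iff_eps_dvd]
    simpa using congrArg TrivSqZeroExt.snd hzero
  choose c hc using heps_dvd
  refine ⟨∑ j, c j • y j, ?_⟩
  rw [Finset.smul_sum]
  exact (hm ()).trans (Finset.sum_congr rfl fun j _ => by rw [hc, mul_smul])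

variable {K : Type*} [Field K]

theorem flat_dualNumber_iff {M : Type*} [AddCommGroup M] [Module K[ε] M] :
    Module.Flat K[ε] M ↔ ∀ m : M, (ε : K[ε]) • m = 0 → ∃ m' : M, m = (ε : K[ε]) • m' := by
  refine ⟨fun _ m => exists_eq_eps_smul_of_flat, fun h => ?_⟩
  rw [Module.Flat.iff_lift_lsmul_comp_subtype_injective]
  intro I _
  obtain ⟨a, rfl, ha⟩ : ∃ a : K[ε], I = Ideal.span {a} ∧ (a = 0 ∨ a = ε ∨ a = 1) := by
    rcases DualNumber.ideal_trichotomy I with rfl | rfl | rfl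
    exacts [⟨0, by simp⟩, ⟨ε, by simp⟩, ⟨1, by simp⟩]
  refine (injective_iff_map_eq_zero _).2 fun t ht => ?_
  obtain ⟨m, rfl⟩ := exists_eq_tmul_of_span_singleton a t
  replace ht : a • m = 0 := by simpa using ht
  rcases ha with rfl | rfl | rfl
  · exact zero_tmul _ _
  · obtain ⟨m', rfl⟩ := h m ht
    have heps : (ε : K[ε]) • (⟨ε, Ideal.mem_span_singleton_self ε⟩ : Ideal.span {(ε : K[ε])}) = 0 :=
      Subtype.ext DualNumber.eps_mul_eps
    rw [← smul_tmul, heps, zero_tmul]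
  · rw [one_smul] at ht
    rw [ht, tmul_zero]

theorem ringHom_flat_dualNumber_iff {T : Type*} [CommRing T] (f : K[ε] →+* T) :
    f.Flat ↔ ∀ t : T, f ε * t = 0 → ∃ t' : T, t = f ε * t' :=
  let _ : Algebra K[ε] T := f.toAlgebra
  flat_dualNumber_iff (M := T)

end DualNumberFlatness

section Deformation

open TrivSqZeroExt

variable {K S : Type*} [Field K] [CommRing S] [Algebra K S]

theorem derivationToHom_apply {I : Ideal S} (D : Derivation K S S) (f : I) :
    derivationToHom K I D f = Ideal.Quotient.mk I (D f) :=
  rfl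

theorem dualNumberInclusion_eps : dualNumberInclusion K S ε = ε :=
  DualNumber.lift_apply_eps _

theorem flat_dualNumberInclusion_quotient_iff (J : Ideal S[ε]) :
    RingHom.Flat (R := K[ε]) (S := S[ε] ⧸ J)
      ((Ideal.Quotient.mk J).comp (dualNumberInclusion K S).toRingHom) ↔
    ∀ z : S[ε], ε * z ∈ J → ∃ w : S[ε], z - ε * w ∈ J := by
  have heps : ((Ideal.Quotient.mk J).comp (dualNumberInclusion K S).toRingHom) ε =
      Ideal.Quotient.mk J ε := congrArg (Ideal.Quotient.mk J) dualNumberInclusion_eps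
  rw [ringHom_flat_dualNumber_iff, Ideal.Quotient.mk_surjective.forall]
  refine forall_congr' fun z => ?_
  rw [heps, Ideal.Quotient.mk_surjective.exists]
  simp only [← map_mul, Ideal.Quotient.eq_zero_iff_mem, Ideal.Quotient.eq]

theorem mem_map_fstHom_iff {J : Ideal S[ε]} {f : S} :
    f ∈ J.map (fstHom S S S) ↔ ∃ z ∈ J, z.fst = f :=
  Ideal.mem_map_iff_of_surjective _ fun s => ⟨inl s, fst_inl S s⟩

theorem mem_map_algebraMap_dualNumber_iff {I : Ideal S} {z : S[ε]} :
    z ∈ I.map (algebraMap S S[ε]) ↔ z.fst ∈ I ∧ z.snd ∈ I := by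
  constructor
  · intro hz
    induction hz using Submodule.span_induction with
    | mem x hx =>
      obtain ⟨s, hs, rfl⟩ := hx
      exact ⟨by simpa [algebraMap_eq_inl] using hs, by simp [algebraMap_eq_inl]⟩
    | zero => simp
    | add x y _ _ hx hy => exact ⟨I.add_mem hx.1 hy.1, I.add_mem hx.2 hy.2⟩
    | smul a x _ hx =>
      refine ⟨by simpa using I.mul_mem_left _ hx.1, ?_⟩
      simpa using I.add_mem (I.mul_mem_left _ hx.2) (I.mul_mem_left _ hx.1)
  · rintro ⟨hfst, hsnd⟩
    have hz : z = algebraMap S S[ε] z.fst + ε * algebraMap S S[ε] z.snd := by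
      ext <;> simp [algebraMap_eq_inl]
    rw [hz]
    exact add_mem (Ideal.mem_map_of_mem _ hfst)
      (Ideal.mul_mem_left _ _ (Ideal.mem_map_of_mem _ hsnd))

/-- The ideal of `S[ε]` of all `f + gε` with `f ∈ I` and `g` a representative of `φ f`; these are
the infinitesimal deformations of `S/I`. -/
def deformationIdeal {I : Ideal S} (φ : I →ₗ[S] S ⧸ I) : Ideal S[ε] where
  carrier := {z | ∃ h : z.fst ∈ I, Ideal.Quotient.mk I z.snd = φ ⟨z.fst, h⟩}
  add_mem' := by
    rintro z w ⟨hz, hφz⟩ ⟨hw, hφw⟩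
    refine ⟨I.add_mem hz hw, ?_⟩
    rw [snd_add, map_add, hφz, hφw, ← map_add]
    rfl
  zero_mem' := ⟨I.zero_mem, by
    rw [snd_zero, map_zero]
    exact (map_zero φ).symm⟩
  smul_mem' := by
    rintro a z ⟨hz, hφz⟩
    have hfst : (a • z).fst ∈ I := by simpa using I.mul_mem_left _ hz
    have hsmul : (⟨(a • z).fst, hfst⟩ : I) = a.fst • (⟨z.fst, hz⟩ : I) := Subtype.ext (by simp)
    refine ⟨hfst, ?_⟩
    rw [hsmul, map_smul, ← hφz, Algebra.smul_def, Ideal.Quotient.algebraMap_eq, ← map_mul,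
      Ideal.Quotient.eq]
    simpa using I.mul_mem_left _ hz

theorem mem_deformationIdeal_iff {I : Ideal S} {φ : I →ₗ[S] S ⧸ I} {z : S[ε]} :
    z ∈ deformationIdeal φ ↔ ∃ h : z.fst ∈ I, Ideal.Quotient.mk I z.snd = φ ⟨z.fst, h⟩ :=
  Iff.rfl

theorem exists_mem_deformationIdeal_fst_eq {I : Ideal S} (φ : I →ₗ[S] S ⧸ I) {f : S} (hf : f ∈ I) :
    ∃ z ∈ deformationIdeal φ, z.fst = f := by
  obtain ⟨g, hg⟩ := Ideal.Quotient.mk_surjective (φ ⟨f, hf⟩)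
  exact ⟨inl f + inr g, ⟨by simpa using hf, by simpa using hg⟩, by simp⟩

variable (K) in
theorem isInfinitesimalDeformation_deformationIdeal {I : Ideal S} (φ : I →ₗ[S] S ⧸ I) :
    IsInfinitesimalDeformation K I (deformationIdeal φ) := by
  refine ⟨(flat_dualNumberInclusion_quotient_iff _).2 fun z ⟨hεz, hφ⟩ => ?_, ?_⟩
  · have hfst : z.fst ∈ I := by
      have hzero : (⟨(ε * z : S[ε]).fst, hεz⟩ : I) = 0 := Subtype.ext (by simp)
      rw [hzero, map_zero] at hφ
      simpa using Ideal.Quotient.eq_zero_iff_mem.1 hφ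
    obtain ⟨w, hw, hwz⟩ := exists_mem_deformationIdeal_fst_eq φ hfst
    refine ⟨inl (z.snd - w.snd), ?_⟩
    convert hw using 1
    ext <;> simp [hwz]
  · ext f
    rw [mem_map_fstHom_iff]
    exact ⟨fun ⟨_, hz, h⟩ => h ▸ hz.1, exists_mem_deformationIdeal_fst_eq φ⟩

namespace IsInfinitesimalDeformation

variable {I : Ideal S} {J : Ideal S[ε]} (hJ : IsInfinitesimalDeformation K I J)

include hJ

theorem fst_mem {z : S[ε]} (hz : z ∈ J) : z.fst ∈ I :=
  hJ.2.le (mem_map_fstHom_iff.2 ⟨z, hz, rfl⟩)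

theorem exists_mem_fst_eq {f : S} (hf : f ∈ I) : ∃ z ∈ J, z.fst = f :=
  mem_map_fstHom_iff.1 (hJ.2.ge hf)

theorem snd_mem_of_fst_eq_zero {z : S[ε]} (hz : z ∈ J) (hfst : z.fst = 0) : z.snd ∈ I := by
  have hεz : z = ε * inl z.snd := by ext <;> simp [hfst]
  obtain ⟨w, hw⟩ := (flat_dualNumberInclusion_quotient_iff J).1 hJ.1 _ (hεz ▸ hz)
  simpa using hJ.fst_mem hw

theorem mk_snd_eq_of_fst_eq {z w : S[ε]} (hz : z ∈ J) (hw : w ∈ J) (h : z.fst = w.fst) :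
    Ideal.Quotient.mk I z.snd = Ideal.Quotient.mk I w.snd := by
  rw [Ideal.Quotient.eq]
  exact hJ.snd_mem_of_fst_eq_zero (J.sub_mem hz hw) (sub_eq_zero.2 h)

theorem inr_mem {f : S} (hf : f ∈ I) : (inr f : S[ε]) ∈ J := by
  obtain ⟨z, hz, rfl⟩ := hJ.exists_mem_fst_eq hf
  have hinr : (inr z.fst : S[ε]) = ε * z := by ext <;> simp
  exact hinr ▸ J.mul_mem_left _ hz

theorem exists_eq_deformationIdeal : ∃ φ : I →ₗ[S] S ⧸ I, J = deformationIdeal φ := by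
  choose lift hlift hfst using fun f : I => hJ.exists_mem_fst_eq f.2
  let φ : I →ₗ[S] S ⧸ I :=
    { toFun := fun f => Ideal.Quotient.mk I (lift f).snd
      map_add' := fun f g => by
        rw [← map_add, ← snd_add]
        exact hJ.mk_snd_eq_of_fst_eq (hlift _) (J.add_mem (hlift _) (hlift _)) (by simp [hfst])
      map_smul' := fun r f => by
        rw [RingHom.id_apply, Algebra.smul_def, Ideal.Quotient.algebraMap_eq, ← map_mul]
        simpa using hJ.mk_snd_eq_of_fst_eq (hlift (r • f))
          (J.mul_mem_left (inl r) (hlift f)) (by simp [hfst]) }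
  refine ⟨φ, le_antisymm (fun z hz => ?_) fun z ⟨hz, hφz⟩ => ?_⟩
  · exact ⟨hJ.fst_mem hz, hJ.mk_snd_eq_of_fst_eq hz (hlift _) (by rw [hfst])⟩
  · have hsnd : z.snd - (lift ⟨z.fst, hz⟩).snd ∈ I := Ideal.Quotient.eq.1 hφz
    have hdecomp : z = lift ⟨z.fst, hz⟩ + inr (z.snd - (lift ⟨z.fst, hz⟩).snd) := by
      ext <;> simp [hfst]
    exact hdecomp ▸ J.add_mem (hlift _) (hJ.inr_mem hsnd)

end IsInfinitesimalDeformation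

section Automorphisms

variable {R : Type*} [CommRing R] [Algebra R S]

/-- The automorphism `s + tε ↦ s + (t + D s)ε` of `S[ε]` given by a derivation `D`. -/
def dualNumberEquivOfDerivation (D : Derivation R S S) : S[ε] ≃ₐ[R] S[ε] where
  toFun z := z + inr (D z.fst)
  invFun z := z - inr (D z.fst)
  left_inv z := by simp
  right_inv z := by simp
  map_add' z w := by
    simp only [fst_add, map_add, inr_add]
    ring
  map_mul' z w := by
    ext
    · simp
    · simp
      ring
  commutes' r := by simp [algebraMap_eq_inl']

variable (σ : S[ε] ≃ₐ[R] S[ε])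

theorem algEquiv_eq_add_mul_eps (z : S[ε]) : σ z = σ (inl z.fst) + σ (inl z.snd) * σ ε := by
  rw [← map_mul, ← map_add]
  congr 1
  ext <;> simp

section Reduced

variable [IsReduced S]

theorem fst_algEquiv_eps : (σ ε).fst = 0 := by
  have hsq : (σ ε).fst * (σ ε).fst = 0 := by
    rw [← fst_mul, ← map_mul, DualNumber.eps_mul_eps, map_zero, fst_zero]
  exact IsNilpotent.eq_zero ⟨2, by rw [sq, hsq]⟩

theorem fst_algEquiv (z : S[ε]) : (σ z).fst = (σ (inl z.fst)).fst := by
  rw [algEquiv_eq_add_mul_eps]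
  simp [fst_algEquiv_eps]

/-- The automorphism of `S` induced by an automorphism of `S[ε]`: over a reduced ring `S`, the
latter preserves the ideal `(ε)` of nilpotent elements. -/
def inducedEquiv : S ≃ₐ[R] S :=
  AlgEquiv.ofAlgHom
    ((fstHom R S S).comp (σ.toAlgHom.comp (inlAlgHom R S S)))
    ((fstHom R S S).comp (σ.symm.toAlgHom.comp (inlAlgHom R S S)))
    (by
      ext s
      change (σ (inl (σ.symm (inl s)).fst)).fst = s
      rw [← fst_algEquiv, AlgEquiv.apply_symm_apply, fst_inl])
    (by
      ext s
      change (σ.symm (inl (σ (inl s)).fst)).fst = s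
      rw [← fst_algEquiv, AlgEquiv.symm_apply_apply, fst_inl])

theorem inducedEquiv_fst (z : S[ε]) : inducedEquiv σ z.fst = (σ z).fst :=
  (fst_algEquiv σ z).symm

theorem snd_algEquiv (z : S[ε]) :
    (σ z).snd = (σ (inl z.fst)).snd + inducedEquiv σ z.snd * (σ ε).snd := by
  have hfst := inducedEquiv_fst σ (inl z.snd)
  rw [fst_inl] at hfst
  rw [algEquiv_eq_add_mul_eps, snd_add, snd_mul, hfst, fst_algEquiv_eps]
  simp

theorem isUnit_snd_algEquiv_eps : IsUnit (σ ε).snd := by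
  refine IsUnit.of_mul_eq_one (inducedEquiv σ (σ.symm ε).snd) ?_
  have h := snd_algEquiv σ (σ.symm ε)
  rw [fst_algEquiv_eps, σ.apply_symm_apply, DualNumber.snd_eps, inl_zero, map_zero, snd_zero,
    zero_add] at h
  rw [mul_comm, ← h]

/-- The derivation `s ↦ τ⁻¹ t` of `S`, where `σ s = τ s + tε` for an automorphism `σ` of `S[ε]`
that induces the automorphism `τ` of `S`. -/
def derivationOfDualNumberEquiv : Derivation R S S :=
  Derivation.mk'
    { toFun := fun s => (inducedEquiv σ).symm (σ (inl s)).snd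
      map_add' := fun s t => by simp
      map_smul' := fun r s => by
        have hsmul : (inl (r • s) : S[ε]) = r • inl s := inl_smul S r s
        rw [hsmul, map_smul, snd_smul, map_smul, RingHom.id_apply] }
    fun s t => by
      have hfst (s : S) : (σ (inl s)).fst = inducedEquiv σ s := (inducedEquiv_fst σ (inl s)).symm
      have hmul : (inl (s * t) : S[ε]) = inl s * inl t := by simp
      simp only [LinearMap.coe_mk, AddHom.coe_mk, hmul, map_mul, snd_mul, hfst, map_add,
        smul_eq_mul, op_smul_eq_mul, AlgEquiv.symm_apply_apply]
      ring

theorem inducedEquiv_symm_snd_algEquiv (z : S[ε]) :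
    (inducedEquiv σ).symm (σ z).snd =
      derivationOfDualNumberEquiv σ z.fst + z.snd * (inducedEquiv σ).symm (σ ε).snd := by
  rw [snd_algEquiv, map_add, map_mul, AlgEquiv.symm_apply_apply]
  rfl

end Reduced

end Automorphisms

theorem dualNumberEquivOfDerivation_mem_deformationIdeal_iff {I : Ideal S} {D : Derivation K S S}
    {z : S[ε]} : dualNumberEquivOfDerivation D z ∈ deformationIdeal (derivationToHom K I D) ↔
      z.fst ∈ I ∧ z.snd ∈ I := by
  have hfst : (dualNumberEquivOfDerivation D z).fst = z.fst := by
    simp [dualNumberEquivOfDerivation]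
  have hsnd : (dualNumberEquivOfDerivation D z).snd = z.snd + D z.fst := by
    simp [dualNumberEquivOfDerivation]
  simp only [mem_deformationIdeal_iff, derivationToHom_apply, hfst, hsnd, Ideal.Quotient.eq,
    add_sub_cancel_right, exists_prop]

theorem isRigidQuotient_of_surjective {I : Ideal S}
    (h : Function.Surjective (derivationToHom K I)) : IsRigidQuotient K I := by
  intro J hJ
  obtain ⟨φ, rfl⟩ := hJ.exists_eq_deformationIdeal
  obtain ⟨D, rfl⟩ := h φ
  refine ⟨(dualNumberEquivOfDerivation D).symm, ?_⟩
  ext z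
  rw [mem_map_algebraMap_dualNumber_iff,
    ← dualNumberEquivOfDerivation_mem_deformationIdeal_iff (D := D), Ideal.mem_map_of_equiv]
  simp [AlgEquiv.symm_apply_eq]

theorem surjective_of_isRigidQuotient [IsReduced S] {I : Ideal S} (h : IsRigidQuotient K I) :
    Function.Surjective (derivationToHom K I) := by
  intro φ
  obtain ⟨σ, hσ⟩ := h _ (isInfinitesimalDeformation_deformationIdeal K φ)
  have hmem (z : S[ε]) : z ∈ deformationIdeal φ ↔ (σ z).fst ∈ I ∧ (σ z).snd ∈ I := by
    rw [← mem_map_algebraMap_dualNumber_iff, ← hσ, Ideal.mem_map_of_equiv]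
    simp
  have hI : ∀ s ∈ I, (inducedEquiv σ).symm s ∈ I := fun s hs =>
    ((hmem (σ.symm (inl s))).2 (by simpa using hs)).1
  obtain ⟨u, hu⟩ := (isUnit_snd_algEquiv_eps σ).map (inducedEquiv σ).symm
  refine ⟨-(↑u⁻¹ : S) • derivationOfDualNumberEquiv σ, LinearMap.ext fun f => ?_⟩
  obtain ⟨g, hg⟩ := Ideal.Quotient.mk_surjective (φ f)
  have hfg : (inl (f : S) + inr g : S[ε]) ∈ deformationIdeal φ :=
    ⟨by simp, by simpa using hg⟩
  have hsnd : derivationOfDualNumberEquiv σ f + g * u ∈ I := by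
    have := hI _ ((hmem _).1 hfg).2
    rwa [inducedEquiv_symm_snd_algEquiv, ← hu, fst_add, snd_add, fst_inl, fst_inr, snd_inl,
      snd_inr, add_zero, zero_add] at this
  rw [← hg, derivationToHom_apply, Ideal.Quotient.eq, Derivation.smul_apply, smul_eq_mul]
  convert I.mul_mem_left (-(↑u⁻¹ : S)) hsnd using 1
  linear_combination g * u.inv_mul

end Deformation

namespace StanleyReisner

open MvPolynomial

section NonfaceIdeal

variable {W : Type*} {𝓕 𝓖 : Set (Set W)} {M N : Finset W}

/-- `N` is a face of the simplicial complex generated by the family `𝓕` of possibly infinite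
vertex sets. -/
def IsFace (𝓕 : Set (Set W)) (N : Finset W) : Prop :=
  ∃ F ∈ 𝓕, ↑N ⊆ F

/-- `N` is a minimal non-face of the simplicial complex generated by `𝓕`. -/
def IsMinimalNonface (𝓕 : Set (Set W)) (N : Finset W) : Prop :=
  Minimal (fun M => ¬ IsFace 𝓕 M) N

theorem IsFace.mono (hN : IsFace 𝓕 N) (hMN : M ⊆ N) : IsFace 𝓕 M :=
  let ⟨F, hF, hNF⟩ := hN
  ⟨F, hF, fun _ hi => hNF (hMN hi)⟩

theorem IsMinimalNonface.isFace_of_ssubset (hN : IsMinimalNonface 𝓕 N) (hMN : M ⊂ N) :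
    IsFace 𝓕 M :=
  not_not.1 (hN.not_prop_of_lt hMN)

theorem exists_isMinimalNonface_subset (hN : ¬ IsFace 𝓕 N) : ∃ M ⊆ N, IsMinimalNonface 𝓕 M :=
  exists_minimal_le_of_wellFoundedLT (fun M => ¬ IsFace 𝓕 M) N hN

theorem isMinimalNonface_of_isFace_erase [DecidableEq W] (hN : ¬ IsFace 𝓕 N)
    (hface : ∀ i ∈ N, IsFace 𝓕 (N.erase i)) : IsMinimalNonface 𝓕 N := by
  refine ⟨hN, fun M hM hMN i hi => ?_⟩
  by_contra hiM
  exact hM ((hface i hi).mono (Finset.subset_erase.2 ⟨hMN, hiM⟩))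

theorem erase_nonempty_of_not_isFace [DecidableEq W] (hN : ¬ IsFace 𝓕 N) {v : W} (hvN : v ∈ N)
    (hv : IsFace 𝓕 {v}) (i : W) : (N.erase i).Nonempty := by
  rw [Finset.nonempty_iff_ne_empty, ne_eq, Finset.erase_eq_empty_iff]
  rintro (rfl | rfl)
  · exact Finset.notMem_empty v hvN
  · exact hN (Finset.mem_singleton.1 hvN ▸ hv)

section RestrictVars

variable (R : Type*) [CommSemiring R]

open Classical in
/-- The endomorphism of the polynomial ring that sets the variables outside `F` to zero. -/
noncomputable def restrictVars (F : Set W) : MvPolynomial W R →ₐ[R] MvPolynomial W R :=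
  aeval fun i => if i ∈ F then X i else 0

variable {R} {F : Set W} {i : W}

theorem restrictVars_X_of_mem (h : i ∈ F) : restrictVars R F (X i) = X i := by
  rw [restrictVars, aeval_X, if_pos h]

theorem restrictVars_X_of_notMem (h : i ∉ F) : restrictVars R F (X i) = 0 := by
  rw [restrictVars, aeval_X, if_neg h]

theorem restrictVars_monomial_of_subset {m : W →₀ ℕ} (a : R) (h : ↑m.support ⊆ F) :
    restrictVars R F (monomial m a) = monomial m a := by
  rw [restrictVars, aeval_monomial, monomial_eq, algebraMap_eq]
  congr 1
  refine Finset.prod_congr rfl fun i hi => ?_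
  simp only [if_pos (h hi)]

theorem restrictVars_monomial_of_not_subset {m : W →₀ ℕ} (a : R) (h : ¬ ↑m.support ⊆ F) :
    restrictVars R F (monomial m a) = 0 := by
  obtain ⟨i, hi, hiF⟩ := Set.not_subset.1 h
  rw [restrictVars, aeval_monomial]
  refine mul_eq_zero_of_right _ (Finset.prod_eq_zero hi ?_)
  simp only [if_neg hiF]
  exact zero_pow (Finsupp.mem_support_iff.1 hi)

open Classical in
theorem coeff_restrictVars (F : Set W) (f : MvPolynomial W R) (m : W →₀ ℕ) :
    coeff m (restrictVars R F f) = if ↑m.support ⊆ F then coeff m f else 0 := by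
  induction f using MvPolynomial.induction_on' with
  | monomial u a =>
    by_cases h : ↑u.support ⊆ F
    · rw [restrictVars_monomial_of_subset a h, coeff_monomial]
      grind
    · rw [restrictVars_monomial_of_not_subset a h, coeff_monomial, coeff_zero]
      grind
  | add p q hp hq =>
    rw [map_add, coeff_add, coeff_add, hp, hq]
    split_ifs <;> simp

theorem restrictVars_eq_zero_iff {f : MvPolynomial W R} :
    restrictVars R F f = 0 ↔ ∀ m ∈ f.support, ¬ ↑m.support ⊆ F := by
  classical
  simp only [MvPolynomial.ext_iff, coeff_restrictVars, coeff_zero, ite_eq_right_iff,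
    mem_support_iff]
  exact forall_congr' fun m => not_imp_not.symm

theorem restrictVars_restrictVars (F G : Set W) (f : MvPolynomial W R) :
    restrictVars R F (restrictVars R G f) = restrictVars R (F ∩ G) f := by
  ext m
  simp only [coeff_restrictVars, Set.subset_inter_iff]
  split_ifs <;> grind

theorem restrictVars_prod_X_of_subset (h : ↑N ⊆ F) :
    restrictVars R F (∏ i ∈ N, X i) = ∏ i ∈ N, X i := by
  rw [map_prod]
  exact Finset.prod_congr rfl fun i hi => restrictVars_X_of_mem (h hi)

theorem restrictVars_prod_X_of_notMem (hiN : i ∈ N) (hiF : i ∉ F) :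
    restrictVars R F (∏ i ∈ N, X i) = 0 := by
  rw [map_prod]
  exact Finset.prod_eq_zero hiN (restrictVars_X_of_notMem hiF)

theorem constantCoeff_restrictVars (F : Set W) (f : MvPolynomial W R) :
    constantCoeff (restrictVars R F f) = constantCoeff f := by
  simp [constantCoeff_eq, coeff_restrictVars]

theorem restrictVars_empty (f : MvPolynomial W R) :
    restrictVars R ∅ f = C (constantCoeff f) := by
  classical
  ext m
  simp only [coeff_restrictVars, coeff_C, constantCoeff_eq, Set.subset_empty_iff,
    Finset.coe_eq_empty, Finsupp.support_eq_empty, eq_comm (a := m)]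
  split_ifs with h
  · rw [h]
  · rfl

end RestrictVars

/-- The exponent vector of the squarefree monomial on `N`. -/
noncomputable def squarefreeExponent (N : Finset W) : W →₀ ℕ := ∑ i ∈ N, Finsupp.single i 1

open Classical in
theorem squarefreeExponent_apply (N : Finset W) (i : W) :
    squarefreeExponent N i = if i ∈ N then 1 else 0 := by
  simp [squarefreeExponent, Finsupp.finsetSum_apply, Finsupp.single_apply]

theorem support_squarefreeExponent (N : Finset W) : (squarefreeExponent N).support = N := by
  ext i
  simp [squarefreeExponent_apply]

theorem squarefreeExponent_le_iff {m : W →₀ ℕ} : squarefreeExponent N ≤ m ↔ N ⊆ m.support := by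
  refine ⟨fun h => support_squarefreeExponent N ▸ Finsupp.support_mono h, fun h i => ?_⟩
  rw [squarefreeExponent_apply]
  split_ifs with hi
  · exact Nat.one_le_iff_ne_zero.2 (Finsupp.mem_support_iff.1 (h hi))
  · exact Nat.zero_le _

section Semiring

variable (R : Type*) [CommSemiring R]

/-- The Stanley–Reisner ideal of the simplicial complex generated by `𝓕`. -/
noncomputable def nonfaceIdeal (𝓕 : Set (Set W)) : Ideal (MvPolynomial W R) :=
  Ideal.span {f | ∃ N : Finset W, ¬ IsFace 𝓕 N ∧ f = ∏ i ∈ N, X i}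

variable {R}

theorem nonfaceIdeal_congr (h : ∀ N, IsFace 𝓕 N ↔ IsFace 𝓖 N) :
    nonfaceIdeal R 𝓕 = nonfaceIdeal R 𝓖 := by
  simp only [nonfaceIdeal, h]

theorem prod_X_mem_nonfaceIdeal (hN : ¬ IsFace 𝓕 N) : ∏ i ∈ N, X i ∈ nonfaceIdeal R 𝓕 :=
  Ideal.subset_span ⟨N, hN, rfl⟩

theorem nonfaceIdeal_eq_span_monomial (𝓕 : Set (Set W)) :
    nonfaceIdeal R 𝓕 = Ideal.span ((fun u => monomial u (1 : R)) ''
      (squarefreeExponent '' {N | ¬ IsFace 𝓕 N})) := by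
  rw [nonfaceIdeal, Set.image_image]
  congr 1
  ext f
  simp only [squarefreeExponent, monomial_sum_one, Set.mem_image, Set.mem_ofPred_eq, eq_comm,
    X]

theorem mem_nonfaceIdeal_iff_support {f : MvPolynomial W R} :
    f ∈ nonfaceIdeal R 𝓕 ↔ ∀ m ∈ f.support, ¬ IsFace 𝓕 m.support := by
  rw [nonfaceIdeal_eq_span_monomial, mem_ideal_span_monomial_image]
  simp only [Set.exists_mem_image, squarefreeExponent_le_iff, Set.mem_ofPred_eq]
  exact forall₂_congr fun m _ =>
    ⟨fun ⟨N, hN, hle⟩ hm => hN (hm.mono hle), fun hm => ⟨_, hm, subset_rfl⟩⟩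

theorem mem_nonfaceIdeal_iff {f : MvPolynomial W R} :
    f ∈ nonfaceIdeal R 𝓕 ↔ ∀ F ∈ 𝓕, restrictVars R F f = 0 := by
  simp only [mem_nonfaceIdeal_iff_support, restrictVars_eq_zero_iff, IsFace]
  grind

theorem monomial_mem_nonfaceIdeal_iff [Nontrivial R] {m : W →₀ ℕ} :
    monomial m (1 : R) ∈ nonfaceIdeal R 𝓕 ↔ ¬ IsFace 𝓕 m.support := by
  classical
  rw [mem_nonfaceIdeal_iff_support, support_monomial, if_neg one_ne_zero]
  simp only [Finset.mem_singleton, forall_eq]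

end Semiring

section Field

variable {K : Type*} [Field K]

theorem isMonomialIdeal_nonfaceIdeal (𝓕 : Set (Set W)) : IsMonomialIdeal (nonfaceIdeal K 𝓕) :=
  ⟨_, nonfaceIdeal_eq_span_monomial 𝓕⟩

theorem IsMinimalNonface.isMinimalGenerator (hN : IsMinimalNonface 𝓕 N) :
    IsMinimalGenerator (nonfaceIdeal K 𝓕) (squarefreeExponent N) := by
  refine ⟨?_, fun u hu hle => squarefreeExponent_le_iff.2 (hN.2 ?_ ?_)⟩
  · refine monomial_mem_nonfaceIdeal_iff.2 ?_
    rw [support_squarefreeExponent]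
    exact hN.1
  · exact monomial_mem_nonfaceIdeal_iff.1 hu
  · exact support_squarefreeExponent N ▸ Finsupp.support_mono hle

end Field

section Quotient

variable {R : Type*} [CommRing R] {F : Set W}

/-- Restriction to the coordinate subspace of a face `F`, as a map out of the Stanley–Reisner
ring. -/
noncomputable def quotientRestrict (hF : F ∈ 𝓕) :
    MvPolynomial W R ⧸ nonfaceIdeal R 𝓕 →ₐ[R] MvPolynomial W R :=
  Ideal.Quotient.liftₐ _ (restrictVars R F) fun _ hf => mem_nonfaceIdeal_iff.1 hf F hF

theorem quotientRestrict_mk (hF : F ∈ 𝓕) (f : MvPolynomial W R) :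
    quotientRestrict hF (Ideal.Quotient.mk _ f) = restrictVars R F f :=
  rfl

theorem quotientRestrict_smul (hF : F ∈ 𝓕) (f : MvPolynomial W R)
    (q : MvPolynomial W R ⧸ nonfaceIdeal R 𝓕) :
    quotientRestrict hF (f • q) = restrictVars R F f * quotientRestrict hF q := by
  obtain ⟨g, rfl⟩ := Ideal.Quotient.mk_surjective q
  exact map_mul (restrictVars R F) f g

theorem quotientRestrict_ext {p q : MvPolynomial W R ⧸ nonfaceIdeal R 𝓕}
    (h : ∀ F (hF : F ∈ 𝓕), quotientRestrict hF p = quotientRestrict hF q) : p = q := by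
  obtain ⟨f, rfl⟩ := Ideal.Quotient.mk_surjective p
  obtain ⟨g, rfl⟩ := Ideal.Quotient.mk_surjective q
  simp only [quotientRestrict_mk] at h
  rw [Ideal.Quotient.eq, mem_nonfaceIdeal_iff]
  exact fun F hF => by rw [map_sub, h F hF, sub_self]

theorem restrictVars_quotientRestrict (hF : F ∈ 𝓕) (q : MvPolynomial W R ⧸ nonfaceIdeal R 𝓕) :
    restrictVars R F (quotientRestrict hF q) = quotientRestrict hF q := by
  obtain ⟨f, rfl⟩ := Ideal.Quotient.mk_surjective q
  rw [quotientRestrict_mk, restrictVars_restrictVars, Set.inter_self]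

theorem constantCoeff_quotientRestrict {G : Set W} (hF : F ∈ 𝓕) (hG : G ∈ 𝓕)
    (q : MvPolynomial W R ⧸ nonfaceIdeal R 𝓕) :
    constantCoeff (quotientRestrict hF q) = constantCoeff (quotientRestrict hG q) := by
  obtain ⟨f, rfl⟩ := Ideal.Quotient.mk_surjective q
  simp only [quotientRestrict_mk, constantCoeff_restrictVars]

end Quotient

end NonfaceIdeal

section IsSplitBy

variable {R W : Type*} [CommSemiring R] {𝓕 : Set (Set W)} {A : Set W} {a b : W}

/-- Every face of the complex generated by `𝓕` lies in `A` or in its complement, so that the complex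
is the disjoint union of its restrictions to `A` and to `Aᶜ`. -/
def IsSplitBy (𝓕 : Set (Set W)) (A : Set W) : Prop :=
  ∀ F ∈ 𝓕, F ⊆ A ∨ F ⊆ Aᶜ

theorem IsSplitBy.X_mul_X_mem_nonfaceIdeal (hA : IsSplitBy 𝓕 A) (ha : a ∈ A) (hb : b ∈ Aᶜ) :
    (X a * X b : MvPolynomial W R) ∈ nonfaceIdeal R 𝓕 := by
  rw [mem_nonfaceIdeal_iff]
  intro F hF
  rw [map_mul]
  rcases hA F hF with h | h
  · rw [restrictVars_X_of_notMem fun hbF => hb (h hbF), mul_zero]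
  · rw [restrictVars_X_of_notMem fun haF => h haF ha, zero_mul]

end IsSplitBy

section UnionOfSimplices

variable {W : Type*} {A : Set W}

section Semiring

variable {R : Type*} [CommSemiring R]

theorem isSplitBy_compl (A : Set W) : IsSplitBy {A, Aᶜ} A := by
  rintro F (rfl | rfl)
  exacts [Or.inl subset_rfl, Or.inr subset_rfl]

theorem X_mul_X_mem_nonfaceIdeal_compl {a b : W} (ha : a ∈ A) (hb : b ∈ Aᶜ) :
    (X a * X b : MvPolynomial W R) ∈ nonfaceIdeal R {A, Aᶜ} :=
  (isSplitBy_compl A).X_mul_X_mem_nonfaceIdeal ha hb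

theorem nonfaceIdeal_compl_eq_span (A : Set W) :
    nonfaceIdeal R {A, Aᶜ} = Ideal.span {f | ∃ a ∈ A, ∃ b ∈ Aᶜ, f = X a * X b} := by
  classical
  refine le_antisymm (Ideal.span_le.2 ?_) (Ideal.span_le.2 ?_)
  · rintro _ ⟨N, hN, rfl⟩
    obtain ⟨b, hbN, hb⟩ := Set.not_subset.1 fun h => hN ⟨A, Or.inl rfl, h⟩
    obtain ⟨a, haN, ha⟩ := Set.not_subset.1 fun h => hN ⟨Aᶜ, Or.inr rfl, h⟩
    rw [Set.notMem_compl_iff] at ha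
    have hba : b ≠ a := fun h => hb (h ▸ ha)
    rw [← Finset.mul_prod_erase N _ haN, ← Finset.mul_prod_erase _ _
      (Finset.mem_erase.2 ⟨hba, hbN⟩), ← mul_assoc]
    exact Ideal.mul_mem_right _ _ (Ideal.subset_span ⟨a, ha, b, hb, rfl⟩)
  · rintro _ ⟨a, ha, b, hb, rfl⟩
    exact X_mul_X_mem_nonfaceIdeal_compl ha hb

theorem X_dvd_restrictVars_singleton {b : W} {f : MvPolynomial W R} (hf : constantCoeff f = 0) :
    X b ∣ restrictVars R {b} f := by
  classical
  rw [← Ideal.mem_span_singleton, ← Set.image_singleton (f := X), mem_ideal_span_X_image]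
  intro m hm
  rw [mem_support_iff, coeff_restrictVars, ne_eq, ite_eq_right_iff, not_forall] at hm
  obtain ⟨hsub, hm⟩ := hm
  refine ⟨b, rfl, fun hmb => hm ?_⟩
  have hzero : m = 0 := by
    rw [← Finsupp.support_eq_empty, Finset.eq_empty_iff_forall_notMem]
    intro i hi
    obtain rfl : i = b := hsub hi
    exact Finsupp.mem_support_iff.1 hi hmb
  rw [hzero]
  exact hf

end Semiring

section Domain

variable {R : Type*} [CommRing R] [IsDomain R]

theorem exists_eq_X_mul_of_nontrivial (hA : A.Nontrivial) {g : A → MvPolynomial W R}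
    (hg : ∀ a a' : A, X (a' : W) * g a = X (a : W) * g a') : ∃ G, ∀ a : A, g a = X (a : W) * G := by
  obtain ⟨a₀, h₀, a₁, h₁, hne⟩ := hA
  have hdvd : X a₀ ∣ X a₁ * g ⟨a₀, h₀⟩ := ⟨_, hg ⟨a₀, h₀⟩ ⟨a₁, h₁⟩⟩
  obtain ⟨G, hG⟩ := (X_prime.dvd_or_dvd hdvd).resolve_left fun h => hne (X_dvd_X.1 h)
  refine ⟨G, fun a => mul_left_cancel₀ (X_ne_zero a₀) ?_⟩
  rw [hg a ⟨a₀, h₀⟩, hG]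
  ring

theorem exists_quotientRestrict_eq_X_mul {𝓕 : Set (Set W)} {F : Set W} (hF : F ∈ 𝓕)
    (hFn : F.Nontrivial)
    (φ : nonfaceIdeal R 𝓕 →ₗ[MvPolynomial W R] MvPolynomial W R ⧸ nonfaceIdeal R 𝓕)
    {g : MvPolynomial W R} (hg : ∀ a ∈ F, X a * g ∈ nonfaceIdeal R 𝓕) :
    ∃ G, ∀ a (ha : a ∈ F), quotientRestrict hF (φ ⟨X a * g, hg a ha⟩) = X a * G := by
  have hcomm (a a' : F) :
      X (a' : W) * quotientRestrict hF (φ ⟨X (a : W) * g, hg a a.2⟩) =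
        X (a : W) * quotientRestrict hF (φ ⟨X (a' : W) * g, hg a' a'.2⟩) := by
    have hsmul : (X (a' : W) : MvPolynomial W R) • (⟨X (a : W) * g, hg a a.2⟩ : nonfaceIdeal R 𝓕) =
        (X (a : W) : MvPolynomial W R) • ⟨X (a' : W) * g, hg a' a'.2⟩ :=
      Subtype.ext (mul_left_comm _ _ _)
    have hφ := congrArg (fun f => quotientRestrict hF (φ f)) hsmul
    rwa [φ.map_smul, φ.map_smul, quotientRestrict_smul, quotientRestrict_smul,
      restrictVars_X_of_mem a.2, restrictVars_X_of_mem a'.2] at hφ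
  obtain ⟨G, hG⟩ := exists_eq_X_mul_of_nontrivial hFn hcomm
  exact ⟨G, fun a ha => hG ⟨a, ha⟩⟩

variable (hA : A.Nontrivial)
  (φ : nonfaceIdeal R {A, Aᶜ} →ₗ[MvPolynomial W R] MvPolynomial W R ⧸ nonfaceIdeal R {A, Aᶜ})
include hA

theorem exists_quotientRestrict_left_eq_X_mul {b : W} (hb : b ∈ Aᶜ) :
    ∃ G, ∀ a (ha : a ∈ A), quotientRestrict (Set.mem_insert A {Aᶜ})
      (φ ⟨X a * X b, X_mul_X_mem_nonfaceIdeal_compl ha hb⟩) = X a * G :=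
  exists_quotientRestrict_eq_X_mul _ hA φ _

theorem exists_quotientRestrict_right_eq_X_mul {a : W} (ha : a ∈ A) :
    ∃ H, ∀ b (hb : b ∈ Aᶜ), quotientRestrict (Set.mem_insert_of_mem A (Set.mem_singleton Aᶜ))
      (φ ⟨X a * X b, X_mul_X_mem_nonfaceIdeal_compl ha hb⟩) = X b * H := by
  rcases (Aᶜ).subsingleton_or_nontrivial with hsub | hnontriv
  · rcases hsub.eq_empty_or_singleton with hempty | ⟨b, hsingle⟩
    · exact ⟨0, fun b hb => absurd hb (hempty ▸ Set.notMem_empty b)⟩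
    have hb : b ∈ Aᶜ := hsingle ▸ rfl
    set q := φ ⟨X a * X b, X_mul_X_mem_nonfaceIdeal_compl ha hb⟩ with hq
    have hconst : constantCoeff
        (quotientRestrict (Set.mem_insert_of_mem A (Set.mem_singleton Aᶜ)) q) = 0 := by
      obtain ⟨G, hG⟩ := exists_quotientRestrict_left_eq_X_mul hA φ hb
      rw [constantCoeff_quotientRestrict _ (Set.mem_insert A {Aᶜ}), hG a ha, map_mul,
        constantCoeff_X, zero_mul]
    obtain ⟨H, hH⟩ := X_dvd_restrictVars_singleton (b := b) hconst
    refine ⟨H, fun b' hb' => ?_⟩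
    obtain rfl : b' = b := hsub hb' hb
    rw [← hH, ← hsingle, restrictVars_quotientRestrict]
  · simp only [mul_comm (X a)]
    exact exists_quotientRestrict_eq_X_mul _ hnontriv φ _

end Domain

variable {K : Type*} [Field K]

open Classical in
theorem surjective_derivationToHom_nonfaceIdeal_compl (hA : A.Nontrivial) :
    Function.Surjective (derivationToHom K (nonfaceIdeal K {A, Aᶜ})) := by
  intro φ
  choose G hG using fun b : ↑Aᶜ => exists_quotientRestrict_left_eq_X_mul hA φ b.2
  choose H hH using fun a : A => exists_quotientRestrict_right_eq_X_mul hA φ a.2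
  let D := mkDerivation K fun i => if hi : i ∈ A then H ⟨i, hi⟩ else G ⟨i, hi⟩
  refine ⟨D, ?_⟩
  rw [Submodule.linearMap_eq_iff_of_eq_span _ _ (nonfaceIdeal_compl_eq_span A)]
  rintro ⟨_, a, ha, b, hb, rfl⟩
  have hD : D (X a * X b) = X a * G ⟨b, hb⟩ + X b * H ⟨a, ha⟩ := by
    rw [Derivation.leibniz, mkDerivation_X, mkDerivation_X, dif_pos ha, dif_neg hb]
    rfl
  refine quotientRestrict_ext fun F hF => ?_
  rw [derivationToHom_apply, quotientRestrict_mk, hD, map_add, map_mul, map_mul,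
    ← restrictVars_quotientRestrict]
  rcases hF with rfl | rfl
  · rw [hG ⟨b, hb⟩ a ha, restrictVars_X_of_notMem hb, zero_mul, add_zero, map_mul]
  · rw [hH ⟨a, ha⟩ b hb, restrictVars_X_of_notMem (Set.notMem_compl_iff.2 ha), zero_mul, zero_add,
      map_mul]

end UnionOfSimplices

section Rename

variable {R W : Type*} [CommSemiring R]

theorem X_mul_X_eq_monomial (i j : W) :
    (X i * X j : MvPolynomial W R) = monomial (Finsupp.single i 1 + Finsupp.single j 1) 1 := by
  rw [X, X, monomial_mul, one_mul]

open Classical in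
theorem mapDomain_elim_apply (v : W) (u : Option W →₀ ℕ) (c : W) :
    u.mapDomain (fun o => o.elim v id) c = u (some c) + if c = v then u none else 0 := by
  induction u using Finsupp.induction_linear with
  | zero => simp
  | add f g hf hg =>
    rw [Finsupp.mapDomain_add, Finsupp.add_apply, hf, hg]
    split_ifs <;> simp only [Finsupp.add_apply] <;> ring
  | single o n =>
    rw [Finsupp.mapDomain_single]
    cases o <;> simp [Finsupp.single_apply, eq_comm]

theorem aeval_elim_eq_rename (v : W) :
    aeval (R := R) (fun o : Option W => o.elim (X v) X) =
      rename (fun o : Option W => o.elim v id) := by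
  ext o
  cases o <;> simp

end Rename

end StanleyReisner

section Separations

open MvPolynomial StanleyReisner

section MonomialIdeals

variable {K W : Type*} [Field K] {J : Ideal (MvPolynomial W K)}

theorem IsMonomialIdeal.exists_mapDomain_le {W' : Type*} {g : W → W'} {m : W' →₀ ℕ}
    (hJ : IsMonomialIdeal J) (hm : monomial m (1 : K) ∈ J.map (rename g)) :
    ∃ u, monomial u (1 : K) ∈ J ∧ u.mapDomain g ≤ m := by
  classical
  obtain ⟨s, rfl⟩ := hJ
  rw [Ideal.map_span, Set.image_image] at hm
  simp only [rename_monomial] at hm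
  rw [← Set.image_image (fun u => monomial u (1 : K)) (Finsupp.mapDomain g) s,
    mem_ideal_span_monomial_image, support_monomial, if_neg one_ne_zero] at hm
  obtain ⟨_, ⟨u, hu, rfl⟩, hle⟩ := hm m (Finset.mem_singleton_self m)
  exact ⟨u, Ideal.subset_span ⟨u, hu, rfl⟩, hle⟩

theorem IsMinimalGenerator.apply_eq_zero {u : W →₀ ℕ} {o o' p : W} (hu : IsMinimalGenerator J u)
    (hcancel : ∀ f, (X o - X o') * f ∈ J → f ∈ J) (hp : p ≠ o') (hup : u p ≠ 0)
    (hXX : X o * X p ∈ J) : u o' = 0 := by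
  by_contra hu'
  obtain ⟨w, rfl⟩ : ∃ w, u = w + Finsupp.single o' 1 :=
    ⟨u - Finsupp.single o' 1, (tsub_add_cancel_of_le
      (Finsupp.single_le_iff.2 (Nat.one_le_iff_ne_zero.2 hu'))).symm⟩
  have hwp : w p ≠ 0 := by
    rwa [Finsupp.add_apply, Finsupp.single_eq_of_ne hp, add_zero] at hup
  have ho' : X o' * monomial w (1 : K) ∈ J := by
    have hmem : monomial (w + Finsupp.single o' 1) (1 : K) ∈ J := hu.1
    rwa [monomial_add_single, pow_one, mul_comm] at hmem
  have ho : X o * monomial w (1 : K) ∈ J := by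
    obtain ⟨q, hq⟩ : X p ∣ monomial w (1 : K) := X_dvd_monomial.2 (Or.inr hwp)
    rw [hq, ← mul_assoc]
    exact J.mul_mem_right _ hXX
  have hw : monomial w (1 : K) ∈ J := hcancel _ (by simpa only [sub_mul] using J.sub_mem ho ho')
  have hle := hu.2 hw le_self_add o'
  rw [Finsupp.add_apply, Finsupp.single_eq_same] at hle
  exact Nat.not_succ_le_self _ hle

end MonomialIdeals

namespace IsSeparation

variable {K W : Type*} [Field K]
  {I : Ideal (MvPolynomial W K)} {v : W} {J : Ideal (MvPolynomial (Option W) K)}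

theorem map_rename_eq (hJ : IsSeparation I v J) :
    J.map (rename fun o : Option W => o.elim v id) = I :=
  aeval_elim_eq_rename (R := K) v ▸ hJ.map_eq

theorem rename_mem (hJ : IsSeparation I v J) {f : MvPolynomial (Option W) K} (hf : f ∈ J) :
    rename (fun o : Option W => o.elim v id) f ∈ I :=
  hJ.map_rename_eq ▸ Ideal.mem_map_of_mem _ hf

theorem mem_of_sub_mul_mem (hJ : IsSeparation I v J) (f : MvPolynomial (Option W) K)
    (hf : (X none - X (some v)) * f ∈ J) : f ∈ J := by
  rw [← Ideal.Quotient.eq_zero_iff_mem] at hf ⊢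
  rw [map_mul] at hf
  exact (mul_left_mem_nonZeroDivisors_eq_zero_iff hJ.regular).1 hf

theorem mem_of_sub_mul_mem' (hJ : IsSeparation I v J) (f : MvPolynomial (Option W) K)
    (hf : (X (some v) - X none) * f ∈ J) : f ∈ J := by
  refine hJ.mem_of_sub_mul_mem f (neg_mem_iff.1 ?_)
  rwa [← neg_mul, neg_sub]

theorem X_mul_X_mem_or (hJ : IsSeparation I v J) {b : W} (hb : b ≠ v) (hvb : X v * X b ∈ I) :
    X (some v) * X (some b) ∈ J ∨ X none * X (some b) ∈ J := by
  classical
  rw [← hJ.map_rename_eq, X_mul_X_eq_monomial] at hvb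
  obtain ⟨u, hu, hle⟩ := hJ.monomial.exists_mapDomain_le hvb
  replace hle (c : W) : u (some c) + (if c = v then u none else 0) ≤
      (if v = c then 1 else 0) + if b = c then 1 else 0 := by
    have hc := hle c
    rwa [mapDomain_elim_apply, Finsupp.add_apply, Finsupp.single_apply,
      Finsupp.single_apply] at hc
  have hlev := hle v
  rw [if_pos rfl, if_pos rfl, if_neg hb] at hlev
  rw [X_mul_X_eq_monomial, X_mul_X_eq_monomial]
  rcases Nat.eq_zero_or_pos (u none) with hzero | hpos
  · refine Or.inl (Ideal.mem_of_dvd J (monomial_one_dvd_monomial_one.2 fun o => ?_) hu)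
    rcases o with _ | c
    · simp [hzero]
    · have hlec := hle c
      simp only [Finsupp.add_apply, Finsupp.single_apply, Option.some_inj]
      grind
  · refine Or.inr (Ideal.mem_of_dvd J (monomial_one_dvd_monomial_one.2 fun o => ?_) hu)
    rcases o with _ | c
    · simp
      omega
    · have hlec := hle c
      simp only [Finsupp.add_apply, Finsupp.single_apply, Option.some_inj]
      grind

theorem X_mul_X_mem (hJ : IsSeparation I v J) {a b : W} (ha : X (some v) * X (some a) ∈ J)
    (hb : X none * X (some b) ∈ J) : X a * X b ∈ I := by
  have hab : (X (some a) * X (some b) : MvPolynomial (Option W) K) ∈ J := by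
    refine hJ.mem_of_sub_mul_mem _ ?_
    convert J.sub_mem (J.mul_mem_left (X (some a)) hb) (J.mul_mem_right (X (some b)) ha) using 1
    ring
  simpa only [map_mul, rename_X, Option.elim_some, id] using hJ.rename_mem hab

end IsSeparation

end Separations

namespace StanleyReisner

open MvPolynomial

section Inseparable

variable {K W : Type*} [Field K] {A : Set W} {v : W} {J : Ideal (MvPolynomial (Option W) K)}

theorem X_mul_X_notMem_nonfaceIdeal_compl {a b : W} (ha : a ∈ Aᶜ) (hb : b ∈ Aᶜ) :
    (X a * X b : MvPolynomial W K) ∉ nonfaceIdeal K {A, Aᶜ} := by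
  intro h
  have h0 := mem_nonfaceIdeal_iff.1 h Aᶜ (Or.inr rfl)
  rw [map_mul, restrictVars_X_of_mem ha, restrictVars_X_of_mem hb] at h0
  exact mul_ne_zero (X_ne_zero a) (X_ne_zero b) h0

theorem exists_apply_some_ne_zero (hJ : IsSeparation (nonfaceIdeal K {A, Aᶜ}) v J) (hv : v ∈ A)
    {u : Option W →₀ ℕ} (hu : monomial u (1 : K) ∈ J) : ∃ b ∈ Aᶜ, u (some b) ≠ 0 := by
  have hmem := hJ.rename_mem hu
  rw [rename_monomial, monomial_mem_nonfaceIdeal_iff] at hmem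
  obtain ⟨b, hb, hbA⟩ := Set.not_subset.1 fun h => hmem ⟨A, Or.inl rfl, h⟩
  refine ⟨b, hbA, ?_⟩
  have hb' := Finsupp.mem_support_iff.1 hb
  rwa [mapDomain_elim_apply, if_neg (ne_of_mem_of_not_mem hv hbA).symm, add_zero] at hb'

theorem forall_X_mul_X_mem_or (hJ : IsSeparation (nonfaceIdeal K {A, Aᶜ}) v J) (hv : v ∈ A) :
    (∀ b ∈ Aᶜ, X (some v) * X (some b) ∈ J) ∨ ∀ b ∈ Aᶜ, X none * X (some b) ∈ J := by
  have hpair (b) (hb : b ∈ Aᶜ) := hJ.X_mul_X_mem_or (ne_of_mem_of_not_mem hv hb).symm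
    (X_mul_X_mem_nonfaceIdeal_compl hv hb)
  by_contra! ⟨⟨b, hb, hvb⟩, a, ha, hna⟩
  exact X_mul_X_notMem_nonfaceIdeal_compl ha hb
    (hJ.X_mul_X_mem ((hpair a ha).resolve_right hna) ((hpair b hb).resolve_left hvb))

theorem not_isSeparation_nonfaceIdeal_compl (hv : v ∈ A) :
    ¬ IsSeparation (nonfaceIdeal K {A, Aᶜ}) v J := by
  intro hJ
  rcases forall_X_mul_X_mem_or hJ hv with hx | hy
  · obtain ⟨u, hu, hu0⟩ := hJ.dvd_y
    obtain ⟨b, hb, hub⟩ := exists_apply_some_ne_zero hJ hv hu.1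
    exact hu0 (hu.apply_eq_zero hJ.mem_of_sub_mul_mem' (Option.some_ne_none b) hub (hx b hb))
  · obtain ⟨u, hu, hu0⟩ := hJ.dvd_x
    obtain ⟨b, hb, hub⟩ := exists_apply_some_ne_zero hJ hv hu.1
    have hbv : some b ≠ some v := fun h => hb (Option.some_injective _ h ▸ hv)
    exact hu0 (hu.apply_eq_zero hJ.mem_of_sub_mul_mem hbv hub (hy b hb))

end Inseparable

section CotangentDegree

variable {K V : Type*} [Field K] {I : Ideal (MvPolynomial V K)}

theorem mem_range_of_cotangentT1Degree_eq_bot {c : V → ℤ} (h : cotangentT1Degree I c = ⊥)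
    {φ : I →ₗ[MvPolynomial V K] MvPolynomial V K ⧸ I} (hφ : φ ∈ homDegree I c) :
    φ ∈ LinearMap.range (derivationToHom K I) :=
  (Submodule.Quotient.mk_eq_zero _).1 (LinearMap.le_ker_iff_map.2 h hφ)

theorem cotangentT1Degree_eq_bot_of_surjective (h : Function.Surjective (derivationToHom K I))
    (c : V → ℤ) : cotangentT1Degree I c = ⊥ :=
  LinearMap.le_ker_iff_map.1 fun φ _ => (Submodule.Quotient.mk_eq_zero _).2 (h φ)

theorem mk_monomial_mem_quotientDegree {d : V → ℤ} {m : V →₀ ℕ} (h : ∀ i, (m i : ℤ) = d i)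
    (c : K) : Ideal.Quotient.mk I (monomial m c) ∈ quotientDegree I d := by
  have hc : monomial m c = c • monomial m (1 : K) := by
    rw [smul_monomial, smul_eq_mul, mul_one]
  rw [hc]
  exact (quotientDegree I d).smul_mem c (Submodule.subset_span ⟨m, h, rfl⟩)

end CotangentDegree

section PderivRestrict

variable {W : Type*} {𝓕 : Set (Set W)} {A : Set W} {v : W}

theorem constantCoeff_pderiv_of_mem_nonfaceIdeal {R : Type*} [CommSemiring R]
    (hv : IsFace 𝓕 {v}) {f : MvPolynomial W R} (hf : f ∈ nonfaceIdeal R 𝓕) :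
    constantCoeff (pderiv v f) = 0 := by
  rw [constantCoeff_eq, coeff_pderiv, zero_add]
  refine mul_eq_zero_of_left (notMem_support_iff.1 fun h => ?_) _
  exact mem_nonfaceIdeal_iff_support.1 hf _ h (hv.mono Finsupp.support_single_subset)

section CommRing

variable {R : Type*} [CommRing R]

/-- The homomorphism `f ↦ (∂f/∂x_v)|_{x_a = 0, a ∈ A}` on the Stanley–Reisner ideal of a complex
split by `A`. It has degree `-v`, so it is an obstruction to `∅`-rigidity unless it is induced by a
derivation. -/
noncomputable def pderivRestrictHom (hA : IsSplitBy 𝓕 A) (hv : IsFace 𝓕 {v}) :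
    nonfaceIdeal R 𝓕 →ₗ[MvPolynomial W R] MvPolynomial W R ⧸ nonfaceIdeal R 𝓕 where
  toFun f := Ideal.Quotient.mk _ (restrictVars R Aᶜ (pderiv v f))
  map_add' f g := by rw [Submodule.coe_add, map_add, map_add, map_add]
  map_smul' s f := by
    refine Ideal.Quotient.eq.2 (mem_nonfaceIdeal_iff.2 fun F hF => ?_)
    simp only [Submodule.coe_smul, RingHom.id_apply, smul_eq_mul, map_sub, map_mul,
      restrictVars_restrictVars]
    rcases hA F hF with hFA | hFA
    · have hempty : F ∩ Aᶜ = ∅ := by rwa [← Set.sdiff_eq, Set.sdiff_eq_empty]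
      rw [hempty, restrictVars_empty, restrictVars_empty,
        constantCoeff_pderiv_of_mem_nonfaceIdeal hv f.2,
        constantCoeff_pderiv_of_mem_nonfaceIdeal hv (Ideal.mul_mem_left _ s f.2), C_0, mul_zero,
        sub_zero]
    · rw [Set.inter_eq_left.2 hFA, Derivation.leibniz, smul_eq_mul, smul_eq_mul, map_add, map_mul,
        map_mul, mem_nonfaceIdeal_iff.1 f.2 F hF, zero_mul, add_zero, sub_self]

theorem pderivRestrictHom_apply (hA : IsSplitBy 𝓕 A) (hv : IsFace 𝓕 {v}) (f : nonfaceIdeal R 𝓕) :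
    pderivRestrictHom hA hv f = Ideal.Quotient.mk _ (restrictVars R Aᶜ (pderiv v f)) :=
  rfl

end CommRing

variable {K : Type*} [Field K] (hA : IsSplitBy 𝓕 A) (hv : IsFace 𝓕 {v})

theorem pderivRestrictHom_mem_homDegree [DecidableEq W] :
    pderivRestrictHom hA hv ∈ homDegree (nonfaceIdeal K 𝓕) (-Pi.single v 1) := by
  intro f u a hf
  rw [pderivRestrictHom_apply, hf, pderiv_monomial]
  by_cases hu : u v = 0
  · rw [hu, Nat.cast_zero, mul_zero, monomial_zero, map_zero, map_zero]
    exact Submodule.zero_mem _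
  by_cases h : ↑(u - Finsupp.single v 1).support ⊆ Aᶜ
  · rw [restrictVars_monomial_of_subset _ h]
    refine mk_monomial_mem_quotientDegree (fun i => ?_) _
    rw [Finsupp.tsub_apply, Finsupp.single_apply, Pi.neg_apply, Pi.single_apply]
    grind
  · rw [restrictVars_monomial_of_not_subset _ h, map_zero]
    exact Submodule.zero_mem _

variable {hA hv} {D : Derivation K (MvPolynomial W K) (MvPolynomial W K)}
  (hD : derivationToHom K (nonfaceIdeal K 𝓕) D = pderivRestrictHom hA hv)
include hD

theorem restrictVars_apply_of_derivationToHom_eq {f : MvPolynomial W K}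
    (hf : f ∈ nonfaceIdeal K 𝓕) {F : Set W} (hF : F ∈ 𝓕) :
    restrictVars K F (D f) = restrictVars K (F ∩ Aᶜ) (pderiv v f) := by
  have hmk := congrArg (quotientRestrict hF) (LinearMap.congr_fun hD ⟨f, hf⟩)
  rwa [derivationToHom_apply, pderivRestrictHom_apply, quotientRestrict_mk, quotientRestrict_mk,
    restrictVars_restrictVars] at hmk

theorem constantCoeff_X_eq_one_of_derivationToHom_eq {w : W} (hvA : v ∈ A) (hwA : w ∈ Aᶜ)
    (hw : IsFace 𝓕 {w}) : constantCoeff (D (X v)) = 1 := by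
  classical
  obtain ⟨F, hF, hwF⟩ := hw
  rw [Finset.coe_singleton, Set.singleton_subset_iff] at hwF
  have hFA : F ⊆ Aᶜ := (hA F hF).resolve_left fun h => hwA (h hwF)
  have hvF : v ∉ F := fun h => hFA h hvA
  have hDvw := restrictVars_apply_of_derivationToHom_eq hD
    (hA.X_mul_X_mem_nonfaceIdeal hvA hwA) hF
  rw [Set.inter_eq_left.2 hFA, Derivation.leibniz, Derivation.leibniz, pderiv_X_self,
    pderiv_X_of_ne (ne_of_mem_of_not_mem hvA hwA).symm] at hDvw
  simp only [smul_eq_mul, map_add, map_mul, map_one, map_zero, restrictVars_X_of_mem hwF,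
    restrictVars_X_of_notMem hvF, zero_mul, zero_add] at hDvw
  rw [← constantCoeff_restrictVars F, mul_left_cancel₀ (X_ne_zero w) hDvw, map_one]

theorem constantCoeff_X_eq_zero_of_derivationToHom_eq {N : Finset W} (hN : IsMinimalNonface 𝓕 N)
    (hNA : ↑N ⊆ A) (hvN : v ∈ N) : constantCoeff (D (X v)) = 0 := by
  classical
  obtain ⟨F, hF, hNF⟩ := hN.isFace_of_ssubset (Finset.erase_ssubset hvN)
  have hvF : v ∉ F := fun hvF => hN.1 ⟨F, hF, by
    rw [← Finset.insert_erase hvN, Finset.coe_insert]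
    exact Set.insert_subset hvF hNF⟩
  obtain ⟨j, hj⟩ := erase_nonempty_of_not_isFace hN.1 hvN hv v
  have hjA : j ∉ F ∩ Aᶜ := fun h => h.2 (hNA (Finset.mem_of_mem_erase hj))
  have hmem : (X v * ∏ i ∈ N.erase v, X i : MvPolynomial W K) ∈ nonfaceIdeal K 𝓕 := by
    rw [Finset.mul_prod_erase N _ hvN]
    exact prod_X_mem_nonfaceIdeal hN.1
  have hDN := restrictVars_apply_of_derivationToHom_eq hD hmem hF
  simp only [Derivation.leibniz, smul_eq_mul, map_add, map_mul, pderiv_X_self,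
    restrictVars_prod_X_of_subset hNF, restrictVars_prod_X_of_notMem hj hjA,
    restrictVars_X_of_notMem hvF, restrictVars_X_of_notMem fun h : v ∈ F ∩ Aᶜ => hvF h.1,
    zero_mul, zero_add] at hDN
  have hprod : (∏ i ∈ N.erase v, X i : MvPolynomial W K) ≠ 0 :=
    Finset.prod_ne_zero_iff.2 fun i _ => X_ne_zero i
  rw [← constantCoeff_restrictVars F, (mul_eq_zero.1 hDN).resolve_left hprod, map_zero]

end PderivRestrict

theorem pderivRestrictHom_notMem_range {K W : Type*} [Field K] {𝓕 : Set (Set W)} {A : Set W}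
    {v w : W} {N : Finset W} (hA : IsSplitBy 𝓕 A) (hv : IsFace 𝓕 {v}) (hN : IsMinimalNonface 𝓕 N)
    (hNA : ↑N ⊆ A) (hvN : v ∈ N) (hwA : w ∈ Aᶜ) (hw : IsFace 𝓕 {w}) :
    pderivRestrictHom hA hv ∉ LinearMap.range (derivationToHom K (nonfaceIdeal K 𝓕)) := by
  rintro ⟨D, hD⟩
  exact one_ne_zero ((constantCoeff_X_eq_one_of_derivationToHom_eq hD (hNA hvN) hwA hw).symm.trans
    (constantCoeff_X_eq_zero_of_derivationToHom_eq hD hN hNA hvN))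

section DivMonomial

variable {W : Type*}

section CommRing

variable {R : Type*} [CommRing R]

/-- The homomorphism on the ideal generated by `x^e` that maps `x^e` to `1`; it has degree `-e`. -/
noncomputable def divMonomialHom (R : Type*) [CommRing R] (e : W →₀ ℕ) :
    (Ideal.span {monomial e (1 : R)} : Ideal (MvPolynomial W R)) →ₗ[MvPolynomial W R]
      MvPolynomial W R ⧸ Ideal.span {monomial e (1 : R)} where
  toFun f := Ideal.Quotient.mk _ (divMonomial (f : MvPolynomial W R) e)
  map_add' f g := by rw [Submodule.coe_add, add_divMonomial, map_add]
  map_smul' s f := by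
    obtain ⟨g, hg⟩ := Ideal.mem_span_singleton.1 f.2
    rw [Submodule.coe_smul, hg, smul_eq_mul, mul_left_comm, divMonomial_monomial_mul,
      divMonomial_monomial_mul]
    rfl

theorem divMonomialHom_apply (e : W →₀ ℕ)
    (f : (Ideal.span {monomial e (1 : R)} : Ideal (MvPolynomial W R))) :
    divMonomialHom R e f = Ideal.Quotient.mk _ (divMonomial (f : MvPolynomial W R) e) :=
  rfl

end CommRing

variable {K : Type*} [Field K]

theorem divMonomialHom_mem_homDegree (e : W →₀ ℕ) :
    divMonomialHom K e ∈ homDegree _ (-fun v => (e v : ℤ)) := by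
  intro f u a hf
  rw [divMonomialHom_apply, hf]
  by_cases ha : a = 0
  · rw [ha, monomial_zero, zero_divMonomial, map_zero]
    exact Submodule.zero_mem _
  have hle : e ≤ u := by
    have hdvd := Ideal.mem_span_singleton.1 f.2
    rw [hf, monomial_dvd_monomial] at hdvd
    exact hdvd.1.resolve_left ha
  have hu : monomial u a = monomial e 1 * monomial (u - e) a := by
    rw [monomial_mul, one_mul, add_tsub_cancel_of_le hle]
  rw [hu, divMonomial_monomial_mul]
  refine mk_monomial_mem_quotientDegree (fun i => ?_) _
  rw [Finsupp.tsub_apply, Nat.cast_sub (hle i), Pi.neg_apply, sub_eq_add_neg]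

theorem divMonomialHom_notMem_range (a b : W) :
    divMonomialHom K (Finsupp.single a 1 + Finsupp.single b 1) ∉
      LinearMap.range (derivationToHom K _) := by
  rintro ⟨D, hD⟩
  have hmk := LinearMap.congr_fun hD ⟨_, Ideal.mem_span_singleton_self _⟩
  rw [divMonomialHom_apply, divMonomial_monomial, derivationToHom_apply] at hmk
  obtain ⟨g, hg⟩ := Ideal.mem_span_singleton.1 (Ideal.Quotient.eq.1 hmk)
  rw [← X_mul_X_eq_monomial, Derivation.leibniz] at hg
  simpa using congrArg constantCoeff hg

end DivMonomial

section Nonfaces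

variable {W W' : Type*} {R : Type*} [CommSemiring R] {𝓕 : Set (Set W)} {𝓖 : Set (Set W')}
  {g : W → W'}

theorem map_rename_nonfaceIdeal_le [DecidableEq W']
    (h : ∀ M : Finset W, IsFace 𝓖 (M.image g) → IsFace 𝓕 M) :
    (nonfaceIdeal R 𝓕).map (rename g) ≤ nonfaceIdeal R 𝓖 := by
  rw [Ideal.map_le_iff_le_comap, nonfaceIdeal, Ideal.span_le]
  rintro _ ⟨M, hM, rfl⟩
  rw [SetLike.mem_coe, Ideal.mem_comap, map_prod, mem_nonfaceIdeal_iff]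
  intro F hF
  obtain ⟨_, hj, hjF⟩ := Set.not_subset.1 fun hMF => hM (h M ⟨F, hF, hMF⟩)
  obtain ⟨i, hi, rfl⟩ := Finset.mem_image.1 hj
  rw [map_prod]
  exact Finset.prod_eq_zero hi (by rw [rename_X, restrictVars_X_of_notMem hjF])

theorem nonfaceIdeal_le_map_rename [DecidableEq W'] (h : ∀ N : Finset W', ¬ IsFace 𝓖 N →
      ∃ M : Finset W, ¬ IsFace 𝓕 M ∧ Set.InjOn g M ∧ M.image g = N) :
    nonfaceIdeal R 𝓖 ≤ (nonfaceIdeal R 𝓕).map (rename g) := by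
  rw [nonfaceIdeal, Ideal.span_le]
  rintro _ ⟨N, hN, rfl⟩
  obtain ⟨M, hM, hinj, rfl⟩ := h N hN
  have hmem := Ideal.mem_map_of_mem (rename g) (prod_X_mem_nonfaceIdeal (R := R) hM)
  rw [map_prod] at hmem
  rw [SetLike.mem_coe, Finset.prod_image hinj]
  simpa only [rename_X] using hmem

end Nonfaces

section Regularity

variable {R W : Type*} [CommRing R] [IsDomain R] {𝓕 : Set (Set W)}

theorem mk_mem_nonZeroDivisors_of_restrictVars_ne_zero {f : MvPolynomial W R}
    (hf : ∀ F ∈ 𝓕, restrictVars R F f ≠ 0) :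
    Ideal.Quotient.mk (nonfaceIdeal R 𝓕) f ∈ nonZeroDivisors _ := by
  rw [mem_nonZeroDivisors_iff_right]
  refine Ideal.Quotient.mk_surjective.forall.2 fun g hg => ?_
  rw [← map_mul, Ideal.Quotient.eq_zero_iff_mem, mem_nonfaceIdeal_iff] at hg
  rw [Ideal.Quotient.eq_zero_iff_mem, mem_nonfaceIdeal_iff]
  intro F hF
  have hgF := hg F hF
  rw [map_mul] at hgF
  exact (mul_eq_zero.1 hgF).resolve_right (hf F hF)

theorem restrictVars_X_sub_X_ne_zero {F : Set W} {i j : W} (hij : i ≠ j) (h : i ∈ F ∨ j ∈ F) :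
    restrictVars R F (X i - X j) ≠ 0 := by
  rw [map_sub, sub_ne_zero]
  by_cases hi : i ∈ F <;> by_cases hj : j ∈ F
  · rw [restrictVars_X_of_mem hi, restrictVars_X_of_mem hj]
    exact X_injective.ne hij
  · rw [restrictVars_X_of_mem hi, restrictVars_X_of_notMem hj]
    exact X_ne_zero i
  · rw [restrictVars_X_of_notMem hi, restrictVars_X_of_mem hj]
    exact (X_ne_zero j).symm
  · exact absurd h (not_or.2 ⟨hi, hj⟩)

end Regularity

section SplitFaces

variable {W : Type*} {𝓕 : Set (Set W)} {A : Set W} {v w : W}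

theorem IsSplitBy.subset_of_mem (hA : IsSplitBy 𝓕 A) {F : Set W} (hF : F ∈ 𝓕) (hvF : v ∈ F)
    (hvA : v ∈ A) : F ⊆ A :=
  (hA F hF).resolve_right fun h => h hvF hvA

theorem IsSplitBy.subset_compl_of_mem (hA : IsSplitBy 𝓕 A) {F : Set W} (hF : F ∈ 𝓕) (hwF : w ∈ F)
    (hwA : w ∈ Aᶜ) : F ⊆ Aᶜ :=
  (hA F hF).resolve_left fun h => hwA (h hwF)

/-- The complex obtained from a complex split by `A` by separating the vertex `v` into `some v` and
a new vertex `none`: it is generated by the cones with apex `none` over the faces in `A` and the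
cones with apex `some v` over the faces in `Aᶜ`. -/
def splitFaces (𝓕 : Set (Set W)) (A : Set W) (v : W) : Set (Set (Option W)) :=
  {G | ∃ F ∈ 𝓕, F ⊆ A ∧ G = insert none (some '' F)} ∪
    {G | ∃ F ∈ 𝓕, F ⊆ Aᶜ ∧ G = insert (some v) (some '' F)}

theorem isFace_splitFaces {M : Finset (Option W)} : IsFace (splitFaces 𝓕 A v) M ↔
    (∃ F ∈ 𝓕, F ⊆ A ∧ ∀ i, some i ∈ M → i ∈ F) ∨
      ∃ F ∈ 𝓕, F ⊆ Aᶜ ∧ none ∉ M ∧ ∀ i, some i ∈ M → i = v ∨ i ∈ F := by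
  simp only [IsFace, splitFaces, Set.mem_union, Set.mem_ofPred_eq, or_and_right, exists_or]
  refine or_congr ⟨?_, ?_⟩ ⟨?_, ?_⟩
  · rintro ⟨_, ⟨F, hF, hFA, rfl⟩, hM⟩
    exact ⟨F, hF, hFA, fun i hi => by simpa using hM hi⟩
  · rintro ⟨F, hF, hFA, hM⟩
    exact ⟨_, ⟨F, hF, hFA, rfl⟩, by rintro (_ | i) hi <;> simp_all⟩
  · rintro ⟨_, ⟨F, hF, hFA, rfl⟩, hM⟩
    exact ⟨F, hF, hFA, fun h => by simpa using hM h, fun i hi => by simpa using hM hi⟩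
  · rintro ⟨F, hF, hFA, hnone, hM⟩
    exact ⟨_, ⟨F, hF, hFA, rfl⟩, by rintro (_ | i) hi <;> simp_all⟩

theorem map_rename_nonfaceIdeal_splitFaces {R : Type*} [CommSemiring R] (hA : IsSplitBy 𝓕 A)
    (hv : IsFace 𝓕 {v}) (hvA : v ∈ A) :
    (nonfaceIdeal R (splitFaces 𝓕 A v)).map (rename fun o : Option W => o.elim v id) =
      nonfaceIdeal R 𝓕 := by
  classical
  refine le_antisymm (map_rename_nonfaceIdeal_le fun M hM => ?_)
    (nonfaceIdeal_le_map_rename fun N hN => ?_)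
  · obtain ⟨F, hF, hMF⟩ := hM
    have hmem {o} (ho : o ∈ M) : o.elim v id ∈ F := hMF (Finset.mem_image_of_mem _ ho)
    rw [isFace_splitFaces]
    exact (hA F hF).imp (fun hFA => ⟨F, hF, hFA, fun i hi => hmem hi⟩) fun hFA =>
      ⟨F, hF, hFA, fun ho => hFA (hmem ho) hvA, fun i hi => Or.inr (hmem hi)⟩
  by_cases hM : IsFace (splitFaces 𝓕 A v) (N.map Function.Embedding.some)
  · obtain ⟨F, hF, -, hNF⟩ | ⟨F, hF, hFA, -, hNF⟩ := isFace_splitFaces.1 hM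
    · exact absurd ⟨F, hF, fun i hi => hNF i (Finset.mem_map_of_mem _ hi)⟩ hN
    replace hNF (i) (hi : i ∈ N) : i = v ∨ i ∈ F := hNF i (Finset.mem_map_of_mem _ hi)
    have hvN : v ∈ N := by
      by_contra hvN
      exact hN ⟨F, hF, fun i hi => (hNF i hi).resolve_left (ne_of_mem_of_not_mem hi hvN)⟩
    obtain ⟨j, hj⟩ := erase_nonempty_of_not_isFace hN hvN hv v
    obtain ⟨hjv, hjN⟩ := Finset.mem_erase.1 hj
    refine ⟨insert none ((N.erase v).map Function.Embedding.some), fun hface => ?_, ?_, ?_⟩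
    · obtain ⟨E, -, hEA, hE⟩ | ⟨E, -, -, hnone, -⟩ := isFace_splitFaces.1 hface
      · exact hFA ((hNF j hjN).resolve_left hjv) (hEA (hE j (by simp [hjv, hjN])))
      · exact hnone (Finset.mem_insert_self _ _)
    · rintro (_ | i) hi (_ | k) hk <;> simp_all [eq_comm]
    · ext i
      by_cases hi : i = v <;> simp [hi, hvN]
  · refine ⟨_, hM, ?_, ?_⟩
    · rintro (_ | i) hi (_ | k) hk <;> simp_all
    · ext i
      simp

theorem isMinimalNonface_splitFaces_map_some {N : Finset W} (hA : IsSplitBy 𝓕 A)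
    (hN : IsMinimalNonface 𝓕 N) (hNA : ↑N ⊆ A) (hvN : v ∈ N) (hv : IsFace 𝓕 {v}) :
    IsMinimalNonface (splitFaces 𝓕 A v) (N.map Function.Embedding.some) := by
  classical
  refine isMinimalNonface_of_isFace_erase (fun hface => ?_) fun o ho => ?_
  · obtain ⟨F, hF, -, hNF⟩ | ⟨F, -, hFA, -, hNF⟩ := isFace_splitFaces.1 hface
    · exact hN.1 ⟨F, hF, fun i hi => hNF i (Finset.mem_map_of_mem _ hi)⟩
    · obtain ⟨j, hj⟩ := erase_nonempty_of_not_isFace hN.1 hvN hv v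
      obtain ⟨hjv, hjN⟩ := Finset.mem_erase.1 hj
      exact hFA ((hNF j (Finset.mem_map_of_mem _ hjN)).resolve_left hjv) (hNA hjN)
  · obtain ⟨i, hi, rfl⟩ := Finset.mem_map.1 ho
    obtain ⟨F, hF, hNF⟩ := hN.isFace_of_ssubset (Finset.erase_ssubset hi)
    obtain ⟨j, hj⟩ := erase_nonempty_of_not_isFace hN.1 hvN hv i
    have hFA := hA.subset_of_mem hF (hNF hj) (hNA (Finset.mem_of_mem_erase hj))
    exact isFace_splitFaces.2 (Or.inl ⟨F, hF, hFA, fun k hk => hNF (by simpa [and_comm] using hk)⟩)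

theorem isMinimalNonface_splitFaces_pair [DecidableEq W] (hA : IsSplitBy 𝓕 A) (hvA : v ∈ A)
    (hv : IsFace 𝓕 {v}) (hwA : w ∈ Aᶜ) (hw : IsFace 𝓕 {w}) :
    IsMinimalNonface (splitFaces 𝓕 A v) {none, some w} := by
  refine isMinimalNonface_of_isFace_erase (fun hface => ?_) fun o ho => ?_
  · obtain ⟨F, -, hFA, hF⟩ | ⟨F, -, -, hnone, -⟩ := isFace_splitFaces.1 hface
    · exact hwA (hFA (hF w (by simp)))
    · exact hnone (Finset.mem_insert_self _ _)
  · obtain ⟨E, hE, hvE⟩ := hv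
    obtain ⟨F, hF, hwF⟩ := hw
    rw [Finset.coe_singleton, Set.singleton_subset_iff] at hvE hwF
    rw [isFace_splitFaces]
    obtain rfl | rfl : o = none ∨ o = some w := by simpa using ho
    · exact Or.inr ⟨F, hF, hA.subset_compl_of_mem hF hwF hwA, by simp, by simp [hwF]⟩
    · exact Or.inl ⟨E, hE, hA.subset_of_mem hE hvE hvA, by simp⟩

theorem isSeparation_nonfaceIdeal_splitFaces {K : Type*} [Field K] {N : Finset W}
    (hA : IsSplitBy 𝓕 A) (hN : IsMinimalNonface 𝓕 N) (hNA : ↑N ⊆ A) (hvN : v ∈ N)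
    (hv : IsFace 𝓕 {v}) (hwA : w ∈ Aᶜ) (hw : IsFace 𝓕 {w}) :
    IsSeparation (nonfaceIdeal K 𝓕) v (nonfaceIdeal K (splitFaces 𝓕 A v)) := by
  classical
  have hvA := hNA hvN
  refine ⟨isMonomialIdeal_nonfaceIdeal _, ?_,
    ⟨_, (isMinimalNonface_splitFaces_map_some hA hN hNA hvN hv).isMinimalGenerator, ?_⟩,
    ⟨_, (isMinimalNonface_splitFaces_pair hA hvA hv hwA hw).isMinimalGenerator, ?_⟩,
    mk_mem_nonZeroDivisors_of_restrictVars_ne_zero fun G hG =>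
      restrictVars_X_sub_X_ne_zero (Option.some_ne_none v).symm ?_⟩
  · rw [aeval_elim_eq_rename, map_rename_nonfaceIdeal_splitFaces hA hv hvA]
  · simp [squarefreeExponent_apply, hvN]
  · simp [squarefreeExponent_apply]
  · obtain ⟨F, -, -, rfl⟩ | ⟨F, -, -, rfl⟩ := hG
    exacts [Or.inl (Set.mem_insert _ _), Or.inr (Set.mem_insert _ _)]

end SplitFaces

open PreAbstractSimplicialComplex

section Complexes

variable {K V W : Type*} [Field K] {Δ : PreAbstractSimplicialComplex V}

/-- The faces of a complex, the empty face included, as sets of vertices. -/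
def faceSets (Δ : PreAbstractSimplicialComplex V) : Set (Set V) :=
  insert ∅ ((fun F : Finset V => (F : Set V)) '' Δ.faces)

theorem isFace_faceSets {N : Finset V} : IsFace (faceSets Δ) N ↔ N = ∅ ∨ N ∈ Δ.faces := by
  constructor
  · rintro ⟨_, rfl | ⟨F, hF, rfl⟩, hNF⟩
    · exact Or.inl (Finset.coe_eq_empty.1 (Set.subset_empty_iff.1 hNF))
    · exact N.eq_empty_or_nonempty.imp_right
        ((Δ.isRelLowerSet_faces hF).2 (Finset.coe_subset.1 hNF))
  · rintro (rfl | hN)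
    · exact ⟨∅, Or.inl rfl, Finset.coe_empty.subset⟩
    · exact ⟨N, Or.inr ⟨N, hN, rfl⟩, subset_rfl⟩

theorem stanleyReisnerIdeal_eq_nonfaceIdeal (Δ : PreAbstractSimplicialComplex V) :
    Δ.stanleyReisnerIdeal K = nonfaceIdeal K (faceSets Δ) := by
  simp only [stanleyReisnerIdeal, nonfaceIdeal, isFace_faceSets, not_or,
    Finset.nonempty_iff_ne_empty, ne_eq, and_assoc]

theorem IsMinimalNonface.nonempty_of_faceSets {N : Finset V}
    (hN : IsMinimalNonface (faceSets Δ) N) : N.Nonempty := by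
  rw [Finset.nonempty_iff_ne_empty]
  exact fun h => hN.1 (isFace_faceSets.2 (Or.inl h))

theorem exists_isMinimalNonface_of_ne_top {Γ : PreAbstractSimplicialComplex W} {e : V ↪ W}
    (he : ∀ F : Finset V, F.map e ∈ Γ.faces → F ∈ Δ.faces) (hΔ : Δ ≠ ⊤) :
    ∃ N : Finset W, ↑N ⊆ Set.range e ∧ IsMinimalNonface (faceSets Γ) N := by
  obtain ⟨F, hF, hFΔ⟩ : ∃ F : Finset V, F.Nonempty ∧ F ∉ Δ.faces := by
    by_contra! h
    exact hΔ (top_le_iff.1 h)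
  have hFΓ : ¬ IsFace (faceSets Γ) (F.map e) := by
    rw [isFace_faceSets, Finset.map_eq_empty, not_or]
    exact ⟨hF.ne_empty, fun h => hFΔ (he F h)⟩
  obtain ⟨N, hNF, hN⟩ := exists_isMinimalNonface_subset hFΓ
  exact ⟨N, (Finset.coe_subset.2 hNF).trans (Finset.coe_map_subset_range e F), hN⟩

section SplitComplex

variable {A : Set V} {N : Finset V} (hA : IsSplitBy (faceSets Δ) A) (hAc : Aᶜ.Nonempty)
  (hvert : ∀ v, {v} ∈ Δ.faces) (hN : IsMinimalNonface (faceSets Δ) N) (hNA : ↑N ⊆ A)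
include hA hAc hvert hN hNA

theorem not_isInseparable_of_isMinimalNonface : ¬ Δ.IsInseparable K := by
  obtain ⟨v, hvN⟩ := hN.nonempty_of_faceSets
  obtain ⟨w, hwA⟩ := hAc
  have hface (i : V) : IsFace (faceSets Δ) {i} := isFace_faceSets.2 (Or.inr (hvert i))
  rw [IsInseparable, not_not, stanleyReisnerIdeal_eq_nonfaceIdeal]
  exact ⟨v, _, isSeparation_nonfaceIdeal_splitFaces hA hN hNA hvN (hface v) hwA (hface w)⟩

theorem not_isEmptyRigid_of_isMinimalNonface : ¬ Δ.IsEmptyRigid K := by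
  classical
  intro h
  obtain ⟨v, hvN⟩ := hN.nonempty_of_faceSets
  obtain ⟨w, hwA⟩ := hAc
  have hface (i : V) : IsFace (faceSets Δ) {i} := isFace_faceSets.2 (Or.inr (hvert i))
  have hdeg : cotangentT1Degree (nonfaceIdeal K (faceSets Δ)) (-Pi.single v 1) = ⊥ :=
    stanleyReisnerIdeal_eq_nonfaceIdeal (K := K) Δ ▸ h _ fun i => by
      rw [Pi.single_apply]
      exact (ite_eq_or_eq _ _ _).symm
  exact pderivRestrictHom_notMem_range hA (hface v) hN hNA hvN hwA (hface w)
    (mem_range_of_cotangentT1Degree_eq_bot hdeg (pderivRestrictHom_mem_homDegree hA (hface v)))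

end SplitComplex

theorem not_isEmptyRigid_of_stanleyReisnerIdeal_eq_span {a b : V} (hab : a ≠ b)
    (hΔ : Δ.stanleyReisnerIdeal K =
      Ideal.span {monomial (Finsupp.single a 1 + Finsupp.single b 1) 1}) :
    ¬ Δ.IsEmptyRigid K := by
  classical
  intro h
  refine divMonomialHom_notMem_range (K := K) a b
    (mem_range_of_cotangentT1Degree_eq_bot (hΔ ▸ h _ fun i => ?_) (divMonomialHom_mem_homDegree _))
  rw [Finsupp.add_apply, Finsupp.single_apply, Finsupp.single_apply]
  grind

end Complexes

section DisjointUnion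

variable {V₁ V₂ : Type*} {Δ₁ : PreAbstractSimplicialComplex V₁}
  {Δ₂ : PreAbstractSimplicialComplex V₂}

theorem mem_faces_disjointUnion {G : Finset (V₁ ⊕ V₂)} :
    G ∈ (Δ₁.disjointUnion Δ₂).faces ↔
      (∃ F ∈ Δ₁.faces, F.map .inl = G) ∨ ∃ F ∈ Δ₂.faces, F.map .inr = G := by
  classical
  simp only [Finset.map_eq_image]
  exact Iff.rfl

theorem map_inl_mem_faces_disjointUnion {F : Finset V₁} :
    F.map .inl ∈ (Δ₁.disjointUnion Δ₂).faces ↔ F ∈ Δ₁.faces := by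
  rw [mem_faces_disjointUnion]
  refine ⟨?_, fun hF => Or.inl ⟨F, hF, rfl⟩⟩
  rintro (⟨G, hG, hGF⟩ | ⟨G, hG, hGF⟩)
  · rwa [← Finset.map_injective _ hGF]
  · obtain ⟨i, hi⟩ := (Δ₂.isRelLowerSet_faces hG).1
    simpa using hGF.subset (Finset.mem_map_of_mem .inr hi)

theorem map_inr_mem_faces_disjointUnion {F : Finset V₂} :
    F.map .inr ∈ (Δ₁.disjointUnion Δ₂).faces ↔ F ∈ Δ₂.faces := by
  rw [mem_faces_disjointUnion]
  refine ⟨?_, fun hF => Or.inr ⟨F, hF, rfl⟩⟩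
  rintro (⟨G, hG, hGF⟩ | ⟨G, hG, hGF⟩)
  · obtain ⟨i, hi⟩ := (Δ₁.isRelLowerSet_faces hG).1
    simpa using hGF.subset (Finset.mem_map_of_mem .inl hi)
  · rwa [← Finset.map_injective _ hGF]

theorem singleton_mem_faces_disjointUnion (hvert₁ : ∀ v, {v} ∈ Δ₁.faces)
    (hvert₂ : ∀ v, {v} ∈ Δ₂.faces) (i : V₁ ⊕ V₂) : {i} ∈ (Δ₁.disjointUnion Δ₂).faces := by
  rcases i with i | i
  · exact map_inl_mem_faces_disjointUnion.2 (hvert₁ i)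
  · exact map_inr_mem_faces_disjointUnion.2 (hvert₂ i)

theorem isSplitBy_range_inl (Δ₁ : PreAbstractSimplicialComplex V₁)
    (Δ₂ : PreAbstractSimplicialComplex V₂) :
    IsSplitBy (faceSets (Δ₁.disjointUnion Δ₂)) (Set.range Sum.inl) := by
  rintro _ (rfl | ⟨F, hF, rfl⟩)
  · exact Or.inl (Set.empty_subset _)
  · obtain ⟨G, -, rfl⟩ | ⟨G, -, rfl⟩ := mem_faces_disjointUnion.1 hF
    · exact Or.inl (Finset.coe_map_subset_range .inl G)
    · rw [Set.compl_range_inl]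
      exact Or.inr (Finset.coe_map_subset_range .inr G)

theorem isSplitBy_range_inr (Δ₁ : PreAbstractSimplicialComplex V₁)
    (Δ₂ : PreAbstractSimplicialComplex V₂) :
    IsSplitBy (faceSets (Δ₁.disjointUnion Δ₂)) (Set.range Sum.inr) := fun F hF => by
  rw [Set.compl_range_inr, ← Set.compl_range_inl]
  exact (isSplitBy_range_inl Δ₁ Δ₂ F hF).symm

theorem exists_isSplitBy_isMinimalNonface_disjointUnion [Nonempty V₁] [Nonempty V₂]
    (h : ¬ (Δ₁ = ⊤ ∧ Δ₂ = ⊤)) : ∃ A, IsSplitBy (faceSets (Δ₁.disjointUnion Δ₂)) A ∧ Aᶜ.Nonempty ∧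
      ∃ N : Finset (V₁ ⊕ V₂), ↑N ⊆ A ∧ IsMinimalNonface (faceSets (Δ₁.disjointUnion Δ₂)) N := by
  rcases not_and_or.1 h with h₁ | h₂
  · exact ⟨_, isSplitBy_range_inl Δ₁ Δ₂, Set.compl_range_inl ▸ Set.range_nonempty _,
      exists_isMinimalNonface_of_ne_top (e := .inl) (fun _ => map_inl_mem_faces_disjointUnion.1) h₁⟩
  · exact ⟨_, isSplitBy_range_inr Δ₁ Δ₂, Set.compl_range_inr ▸ Set.range_nonempty _,
      exists_isMinimalNonface_of_ne_top (e := .inr) (fun _ => map_inr_mem_faces_disjointUnion.1) h₂⟩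

section TopTop

variable {K : Type*} [Field K]

theorem isFace_faceSets_top_disjointUnion_top {N : Finset (V₁ ⊕ V₂)} :
    IsFace (faceSets ((⊤ : PreAbstractSimplicialComplex V₁).disjointUnion
      (⊤ : PreAbstractSimplicialComplex V₂))) N ↔
      IsFace {Set.range Sum.inl, (Set.range Sum.inl)ᶜ} N := by
  classical
  constructor
  · rintro ⟨F, hF, hNF⟩
    exact (isSplitBy_range_inl _ _ F hF).elim (fun h => ⟨_, Or.inl rfl, hNF.trans h⟩)
      fun h => ⟨_, Or.inr rfl, hNF.trans h⟩
  · rintro ⟨_, rfl | rfl, hN⟩ <;> rw [isFace_faceSets] <;>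
      refine N.eq_empty_or_nonempty.imp_right fun hne => ?_
    · obtain ⟨M, -, rfl⟩ := Finset.subset_set_image_iff.1 (Set.image_univ ▸ hN)
      exact mem_faces_disjointUnion.2 (Or.inl ⟨M, hne.of_image, Finset.map_eq_image _ _⟩)
    · rw [Set.compl_range_inl] at hN
      obtain ⟨M, -, rfl⟩ := Finset.subset_set_image_iff.1 (Set.image_univ ▸ hN)
      exact mem_faces_disjointUnion.2 (Or.inr ⟨M, hne.of_image, Finset.map_eq_image _ _⟩)

theorem stanleyReisnerIdeal_top_disjointUnion_top :
    ((⊤ : PreAbstractSimplicialComplex V₁).disjointUnion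
      (⊤ : PreAbstractSimplicialComplex V₂)).stanleyReisnerIdeal K =
      nonfaceIdeal K {Set.range Sum.inl, (Set.range Sum.inl)ᶜ} := by
  rw [stanleyReisnerIdeal_eq_nonfaceIdeal]
  exact nonfaceIdeal_congr fun _ => isFace_faceSets_top_disjointUnion_top

theorem isInseparable_top_disjointUnion_top :
    ((⊤ : PreAbstractSimplicialComplex V₁).disjointUnion
      (⊤ : PreAbstractSimplicialComplex V₂)).IsInseparable K := by
  rintro ⟨v, J, hJ⟩
  rw [stanleyReisnerIdeal_top_disjointUnion_top] at hJ
  by_cases hv : v ∈ Set.range (Sum.inl : V₁ → V₁ ⊕ V₂)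
  · exact not_isSeparation_nonfaceIdeal_compl hv hJ
  · refine not_isSeparation_nonfaceIdeal_compl (Set.mem_compl hv) (J := J) ?_
    rwa [compl_compl, Set.pair_comm]

theorem surjective_derivationToHom_top_disjointUnion_top (h : Nontrivial V₁ ∨ Nontrivial V₂) :
    Function.Surjective (derivationToHom K (((⊤ : PreAbstractSimplicialComplex V₁).disjointUnion
      (⊤ : PreAbstractSimplicialComplex V₂)).stanleyReisnerIdeal K)) := by
  rw [stanleyReisnerIdeal_top_disjointUnion_top]
  rcases h with _ | _
  · exact surjective_derivationToHom_nonfaceIdeal_compl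
      (Set.image_univ ▸ Set.nontrivial_univ.image Sum.inl_injective)
  · have hinr : (Set.range (Sum.inl : V₁ → V₁ ⊕ V₂))ᶜ.Nontrivial := by
      rw [Set.compl_range_inl, ← Set.image_univ]
      exact Set.nontrivial_univ.image Sum.inr_injective
    have hsurj := surjective_derivationToHom_nonfaceIdeal_compl (K := K) hinr
    rwa [compl_compl, Set.pair_comm] at hsurj

theorem stanleyReisnerIdeal_top_disjointUnion_top_of_unique [Unique V₁] [Unique V₂] :
    ((⊤ : PreAbstractSimplicialComplex V₁).disjointUnion
      (⊤ : PreAbstractSimplicialComplex V₂)).stanleyReisnerIdeal K =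
      Ideal.span {monomial (Finsupp.single (Sum.inl default) 1 +
        Finsupp.single (Sum.inr default) 1) 1} := by
  rw [stanleyReisnerIdeal_top_disjointUnion_top, nonfaceIdeal_compl_eq_span, Set.compl_range_inl,
    ← X_mul_X_eq_monomial]
  congr 1
  ext f
  simp [Unique.exists_iff]

theorem not_isEmptyRigid_top_disjointUnion_top [Nonempty V₁] [Nonempty V₂] [Subsingleton V₁]
    [Subsingleton V₂] : ¬ ((⊤ : PreAbstractSimplicialComplex V₁).disjointUnion
      (⊤ : PreAbstractSimplicialComplex V₂)).IsEmptyRigid K := by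
  obtain ⟨_⟩ := nonempty_unique V₁
  obtain ⟨_⟩ := nonempty_unique V₂
  exact not_isEmptyRigid_of_stanleyReisnerIdeal_eq_span Sum.inl_ne_inr
    stanleyReisnerIdeal_top_disjointUnion_top_of_unique

end TopTop

end DisjointUnion

section Simplices

variable {V : Type*} {Δ : PreAbstractSimplicialComplex V}

theorem nonempty_of_ne_bot (hΔ : Δ ≠ ⊥) : Nonempty V := by
  obtain ⟨F, hF⟩ : ∃ F, F ∈ Δ.faces := by
    by_contra! h
    exact hΔ (le_bot_iff.1 fun F hF => h F hF)
  exact (Δ.isRelLowerSet_faces hF).1.to_type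

theorem isSimplex_iff_eq_top [Finite V] (hvert : ∀ v, {v} ∈ Δ.faces) : Δ.IsSimplex ↔ Δ = ⊤ := by
  constructor
  · rintro ⟨F, hF⟩
    refine top_le_iff.1 fun G hG => (hF G).2 ⟨hG, fun v _ => ?_⟩
    exact Finset.singleton_subset_iff.1 ((hF {v}).1 (hvert v)).2
  · rintro rfl
    have := Fintype.ofFinite V
    exact ⟨Finset.univ, fun G => (and_iff_left (Finset.subset_univ G)).symm⟩

theorem dim_top [Finite V] [Nonempty V] :
    (⊤ : PreAbstractSimplicialComplex V).dim = Nat.card V - 1 := by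
  have := Fintype.ofFinite V
  have hmax : IsGreatest (Finset.card '' (⊤ : PreAbstractSimplicialComplex V).faces)
      (Nat.card V) := by
    rw [Nat.card_eq_fintype_card]
    refine ⟨⟨Finset.univ, Finset.univ_nonempty, Finset.card_univ⟩, ?_⟩
    rintro _ ⟨F, -, rfl⟩
    exact Finset.card_le_univ F
  rw [dim, hmax.csSup_eq]

theorem dim_top_add_dim_top_pos_iff {V₁ V₂ : Type*} [Finite V₁] [Finite V₂] [Nonempty V₁]
    [Nonempty V₂] : 0 < (⊤ : PreAbstractSimplicialComplex V₁).dim +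
      (⊤ : PreAbstractSimplicialComplex V₂).dim ↔ Nontrivial V₁ ∨ Nontrivial V₂ := by
  rw [dim_top, dim_top, ← Finite.one_lt_card_iff_nontrivial, ← Finite.one_lt_card_iff_nontrivial]
  have hpos₁ := Nat.card_pos (α := V₁)
  have hpos₂ := Nat.card_pos (α := V₂)
  omega

theorem isSimplex_and_dim_pos_iff {V₁ V₂ : Type*} [Finite V₁] [Finite V₂]
    {Δ₁ : PreAbstractSimplicialComplex V₁} {Δ₂ : PreAbstractSimplicialComplex V₂}
    (hne₁ : Δ₁ ≠ ⊥) (hne₂ : Δ₂ ≠ ⊥) (hvert₁ : ∀ v, {v} ∈ Δ₁.faces) (hvert₂ : ∀ v, {v} ∈ Δ₂.faces) :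
    Δ₁.IsSimplex ∧ Δ₂.IsSimplex ∧ 0 < Δ₁.dim + Δ₂.dim ↔
      Δ₁ = ⊤ ∧ Δ₂ = ⊤ ∧ (Nontrivial V₁ ∨ Nontrivial V₂) := by
  have := nonempty_of_ne_bot hne₁
  have := nonempty_of_ne_bot hne₂
  rw [isSimplex_iff_eq_top hvert₁, isSimplex_iff_eq_top hvert₂]
  refine and_congr_right ?_
  rintro rfl
  refine and_congr_right ?_
  rintro rfl
  exact dim_top_add_dim_top_pos_iff

end Simplices

end StanleyReisner

open StanleyReisner

theorem mainTheorem3_general (K : Type*) [Field K] {V₁ V₂ : Type*}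
    (Δ₁ : PreAbstractSimplicialComplex V₁) (Δ₂ : PreAbstractSimplicialComplex V₂)
    (hne₁ : Δ₁ ≠ ⊥) (hne₂ : Δ₂ ≠ ⊥)
    (hvert₁ : ∀ v, {v} ∈ Δ₁.faces) (hvert₂ : ∀ v, {v} ∈ Δ₂.faces) :
    ((Δ₁.disjointUnion Δ₂).IsInseparable K ↔ Δ₁ = ⊤ ∧ Δ₂ = ⊤) ∧
    List.TFAE [
      (Δ₁.disjointUnion Δ₂).IsRigid K,
      (Δ₁.disjointUnion Δ₂).IsEmptyRigid K,
      Δ₁ = ⊤ ∧ Δ₂ = ⊤ ∧ (Nontrivial V₁ ∨ Nontrivial V₂)] := by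
  have := nonempty_of_ne_bot hne₁
  have := nonempty_of_ne_bot hne₂
  have hvert := singleton_mem_faces_disjointUnion hvert₁ hvert₂
  refine ⟨⟨fun hins => ?_, ?_⟩, ?_⟩
  · by_contra htop
    obtain ⟨A, hA, hAc, N, hNA, hN⟩ := exists_isSplitBy_isMinimalNonface_disjointUnion htop
    exact not_isInseparable_of_isMinimalNonface hA hAc hvert hN hNA hins
  · rintro ⟨rfl, rfl⟩
    exact isInseparable_top_disjointUnion_top
  tfae_have 1 → 2 := fun hrigid _ _ =>
    cotangentT1Degree_eq_bot_of_surjective (surjective_of_isRigidQuotient hrigid) _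
  tfae_have 2 → 3 := by
    intro hempty
    obtain ⟨rfl, rfl⟩ : Δ₁ = ⊤ ∧ Δ₂ = ⊤ := by
      by_contra htop
      obtain ⟨A, hA, hAc, N, hNA, hN⟩ := exists_isSplitBy_isMinimalNonface_disjointUnion htop
      exact not_isEmptyRigid_of_isMinimalNonface hA hAc hvert hN hNA hempty
    refine ⟨rfl, rfl, ?_⟩
    by_contra! ⟨_, _⟩
    exact not_isEmptyRigid_top_disjointUnion_top hempty
  tfae_have 3 → 1 := by
    rintro ⟨rfl, rfl, hV⟩
    exact isRigidQuotient_of_surjective (surjective_derivationToHom_top_disjointUnion_top hV)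
  tfae_finish

theorem mainTheorem3 (K : Type*) [Field K] {V₁ V₂ : Type*} [Finite V₁] [Finite V₂]
    (Δ₁ : PreAbstractSimplicialComplex V₁) (Δ₂ : PreAbstractSimplicialComplex V₂)
    (hne₁ : Δ₁ ≠ ⊥) (hne₂ : Δ₂ ≠ ⊥)
    (hvert₁ : ∀ v, {v} ∈ Δ₁.faces) (hvert₂ : ∀ v, {v} ∈ Δ₂.faces) :
    ((Δ₁.disjointUnion Δ₂).IsInseparable K ↔ Δ₁.IsSimplex ∧ Δ₂.IsSimplex) ∧
    List.TFAE [
      (Δ₁.disjointUnion Δ₂).IsRigid K,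
      (Δ₁.disjointUnion Δ₂).IsEmptyRigid K,
      Δ₁.IsSimplex ∧ Δ₂.IsSimplex ∧ 0 < Δ₁.dim + Δ₂.dim] := by
  rw [isSimplex_and_dim_pos_iff hne₁ hne₂ hvert₁ hvert₂, isSimplex_iff_eq_top hvert₁,
    isSimplex_iff_eq_top hvert₂]
  exact mainTheorem3_general K Δ₁ Δ₂ hne₁ hne₂ hvert₁ hvert₂
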